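/- Let $\rho_0,\dots,\rho_n\in\mathbb R$ be fixed densities. Write $\hat f(\xi)=\mathscr F(f)(\xi)=\int_{\mathbb R} f(x)e^{-ix\xi}\,dx$ (understood in the sense of tempered distributions), and, for functions $f$ whose Fourier transform is a function, $\|f\|_s=\int_{\mathbb R}|\xi|^s|\hat f(\xi)|\,d\xi\in[0,\infty]$; put $\|f\|_s=\infty$ if $\hat f$ is not a function. For a function $g_k:\mathbb R\to\mathbb R$ (the perturbation of the $k$-th interface at a fixed time, $1\le k\le n$) let $\Delta_y g_k(x)=\dfrac{g_k(x)-g_k(x-y)}{y}$ and $$N_{k,k}(x)=\frac{\rho_{k-1}-\rho_k}{2\pi}\int_{\mathbb R}\partial_x\Delta_y g_k(x)\,\frac{(\Delta_y g_k(x))^2}{1+(\Delta_y g_k(x))^2}\,dy ,$$ the integral being taken as a principal value at $y=0$ (this is the ordinary integral whenever the latter converges absolutely). For $x\in[0,\infty)$ let $$F_{0,s}(x)=\sum_{l=1}^{\infty}(2l+1)^s x^{2l}\in[0,\infty].$$ **Proposition.** There is a constant $C$, depending only on $\rho_0,\dots,\rho_n$, such that for every $s\ge 0$, every $1\le k\le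 n$ and every continuous $g_k$ with $\|g_k\|_{s+1}<\infty$ and $\|g_k\|_1<\infty$, $$\int_{\mathbb R}|\xi|^s\,|\mathscr F(N_{k,k})(\xi)|\,d\xi\;\le\; C\sum_{l=1}^{\infty}(2l+1)^s\,\|g_k\|_1^{2l}\,\|g_k\|_{s+1}\;=\;C\,F_{0,s}(\|g_k\|_1)\,\|g_k\|_{s+1}.$$ The inequality is in $[0,\infty]$. Whenever $\|g_k\|_1<1$ (so that $F_{0,s}(\|g_k\|_1)<\infty$) the principal value defining $N_{k,k}(x)$ exists for every $x$, and if the right-hand side is finite then $\mathscr F(N_{k,k})$ is a function. -/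

import Mathlib

open MeasureTheory Filter Topology
open scoped ENNReal NNReal SchwartzMap

noncomputable section

/-- The Fourier transform in the normalization `𝓕 f (ξ) = ∫ f(x) e^{-i x ξ} dx`. -/
def fourierInt (f : ℝ → ℂ) (ξ : ℝ) : ℂ :=
  ∫ x : ℝ, f x * Complex.exp (-(Complex.I * x * ξ))

/-- The Fourier transform of the (tempered) function `u` is the function `U`, in the sense of
tempered distributions: `⟨U, φ⟩ = ⟨u, 𝓕 φ⟩` for every Schwartz function `φ`, both pairings being
absolutely convergent. Such a `U` is unique up to null sets; for integrable `u` it is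
`fourierInt u`, see `isFourierTransform_fourierInt`, and for square integrable `u` it is the
Plancherel transform. -/
def IsFourierTransform (u : ℝ → ℝ) (U : ℝ → ℂ) : Prop :=
  ∀ φ : 𝓢(ℝ, ℂ),
    Integrable (fun x : ℝ => (u x : ℂ) * fourierInt φ x) ∧
    Integrable (fun ξ : ℝ => U ξ * φ ξ) ∧
    ∫ ξ : ℝ, U ξ * φ ξ = ∫ x : ℝ, (u x : ℂ) * fourierInt φ x

/-- The Wiener norm `‖u‖_s = ∫ |ξ|^s |𝓕 u (ξ)| dξ ∈ [0, ∞]`. The infimum only serves to select the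
(almost everywhere unique) function `𝓕 u`; the norm is `∞` if the Fourier transform of `u` is not
a function. -/
def wienerNorm (s : ℝ) (u : ℝ → ℝ) : ℝ≥0∞ :=
  ⨅ (U : ℝ → ℂ) (_ : IsFourierTransform u U), ∫⁻ ξ : ℝ, ENNReal.ofReal (|ξ| ^ s) * ‖U ξ‖ₑ

/-- The difference quotient `Δ_y f (x) = (f(x) - f(x - y)) / y`. -/
def diffQuot (f : ℝ → ℝ) (y x : ℝ) : ℝ := (f x - f (x - y)) / y

/-- The integrand `∂ₓΔ_y g(x) (Δ_y g(x))² / (1 + (Δ_y g(x))²)`, as a function of `y`. -/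
def selfKernel (g : ℝ → ℝ) (x y : ℝ) : ℝ :=
  deriv (diffQuot g y) x * (diffQuot g y x ^ 2 / (1 + diffQuot g y x ^ 2))

/-- `L` is the principal value at `0` of `∫ φ(y) dy`. -/
def HasPrincipalValue (φ : ℝ → ℝ) (L : ℝ) : Prop :=
  (∀ ε : ℝ, 0 < ε → IntegrableOn φ {y | ε < |y|}) ∧
    Tendsto (fun ε : ℝ => ∫ y in {y | ε < |y|}, φ y) (𝓝[>] 0) (𝓝 L)

/-- The integral `∫ φ(y) dy`, taken as a principal value at `0`. It is the Lebesgue integral when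
`φ` is integrable, see `principalValue_eq_integral`. -/
def principalValue (φ : ℝ → ℝ) : ℝ :=
  limUnder (𝓝[>] (0 : ℝ)) (fun ε : ℝ => ∫ y in {y | ε < |y|}, φ y)

/-- The self-interaction nonlinearity
`N_{k,k}(x) = (ρ_{k-1} - ρ_k) / (2π) * ∫ ∂ₓΔ_y g(x) (Δ_y g(x))² / (1 + (Δ_y g(x))²) dy`
for the densities `ρ_0, …, ρ_n` and the perturbation `g = g_k` of the `k`-th interface. Here
`k : Fin n` runs over `0, …, n - 1`, so that `ρ k.castSucc` lies below the interface and
`ρ k.succ` above. -/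
def selfInteraction {n : ℕ} (ρ : Fin (n + 1) → ℝ) (k : Fin n) (g : ℝ → ℝ) (x : ℝ) : ℝ :=
  (ρ k.castSucc - ρ k.succ) / (2 * Real.pi) * principalValue (selfKernel g x)

/-- `F_{0,s}(x) = ∑_{l ≥ 1} (2l+1)^s x^{2l} ∈ [0, ∞]`; the summation index is `l - 1`. -/
def seriesF (s : ℝ) (x : ℝ≥0∞) : ℝ≥0∞ :=
  ∑' m : ℕ, ENNReal.ofReal ((2 * ((m : ℝ) + 1) + 1) ^ s) * x ^ (2 * (m + 1))

theorem hasPrincipalValue_integral {φ : ℝ → ℝ} (h : Integrable φ) :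
    HasPrincipalValue φ (∫ y, φ y) := by
  refine ⟨fun ε _ => h.integrableOn, ?_⟩
  have hm : ∀ ε : ℝ, MeasurableSet {y : ℝ | ε < |y|} := fun ε =>
    measurableSet_lt measurable_const measurable_id.abs
  simp_rw [← integral_indicator (hm _)]
  refine tendsto_integral_filter_of_dominated_convergence (fun y => ‖φ y‖) ?_ ?_ h.norm ?_
  · exact Eventually.of_forall fun ε => h.aestronglyMeasurable.indicator (hm ε)
  · exact Eventually.of_forall fun ε => Eventually.of_forall fun y => norm_indicator_le_norm_self _ _
  · have h0 : ∀ᵐ y : ℝ, y ≠ 0 := by simp [ae_iff]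
    filter_upwards [h0] with y hy
    refine tendsto_const_nhds.congr' ?_
    filter_upwards [Ioo_mem_nhdsGT (abs_pos.2 hy)] with ε hε
    simp [Set.indicator, hε.2]

theorem principalValue_eq_integral {φ : ℝ → ℝ} (h : Integrable φ) :
    principalValue φ = ∫ y, φ y :=
  (hasPrincipalValue_integral h).2.limUnder_eq

theorem fourierInt_eq_vectorFourier (f : ℝ → ℂ) :
    fourierInt f =
      VectorFourier.fourierIntegral Real.probChar volume (LinearMap.mul ℝ ℝ) f := by
  funext ξ
  simp only [fourierInt, VectorFourier.fourierIntegral]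
  congr 1 with x
  rw [Circle.smul_def, Real.probChar_apply, smul_eq_mul, mul_comm]
  congr 2
  simp
  ring

theorem isFourierTransform_fourierInt {u : ℝ → ℝ} (h : Integrable u) :
    IsFourierTransform u (fourierInt fun x => (u x : ℂ)) := by
  intro φ
  have hc : Continuous fun p : ℝ × ℝ => LinearMap.mul ℝ ℝ p.1 p.2 := by
    simpa using continuous_mul
  have he : Continuous (Real.probChar : ℝ → Circle) := Real.continuous_probChar
  have bd : ∀ {f : ℝ → ℂ}, Integrable f → Continuous (fourierInt f) ∧
      ∀ ξ, ‖fourierInt f ξ‖ ≤ ∫ x, ‖f x‖ := by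
    intro f hf
    rw [fourierInt_eq_vectorFourier]
    exact ⟨VectorFourier.fourierIntegral_continuous he hc hf,
      VectorFourier.norm_fourierIntegral_le_integral_norm _ _ _ _⟩
  have hu : Integrable fun x => (u x : ℂ) := h.ofReal
  have hφ : Integrable (φ : ℝ → ℂ) := φ.integrable
  refine ⟨hu.mul_bdd (bd hφ).1.aestronglyMeasurable (Eventually.of_forall (bd hφ).2),
    hφ.bdd_mul (bd hu).1.aestronglyMeasurable (Eventually.of_forall (bd hu).2), ?_⟩
  have key := VectorFourier.integral_fourierIntegral_smul_eq_flip he hc hu hφ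
  have hflip : (LinearMap.mul ℝ ℝ).flip = LinearMap.mul ℝ ℝ := by
    ext
    simp
  rw [hflip, ← fourierInt_eq_vectorFourier, ← fourierInt_eq_vectorFourier] at key
  simpa only [smul_eq_mul] using key

end

noncomputable section

open scoped FourierTransform

/-! Suppose first that `‖g‖_1 < 1`. Fourier inversion writes `g` as `waveInt V` with `V = ĝ / 2π`,
and `g'` as `waveInt h` with `h(ξ) = iξ V(ξ)`. Then `|Δ_y g| ≤ ∫ |h| < 1`, so `q² / (1 + q²)`
expands into the geometric series `∑ (-1)^m q^(2(m+1))` with `q = Δ_y g`. It remains to treat `∂ₓΔ_y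
g (Δ_y g)^p` for `p = 2(m+1)`.

Each such product is a superposition of waves `e^{ix(ξ + ∑ ωⱼ)}` with amplitude `h(ξ) ∏ h(ωⱼ)` times
the symbol `(1 - e^{-iyξ})/y · ∏ avgExp(y ωⱼ)`. The heart of the proof is that the `y`-integral of
this symbol is bounded by 12, uniformly in `p`, in the frequencies and in the truncation `ε`. Indeed
`∏ avgExp(y ωⱼ)` is an average of exponentials `e^{-iyA}`, so the symbol is an average of
differences of functions `e^{-iyA}/y`, and their symmetric integrals are truncated sine integrals
(`norm_setIntegral_annulus_exp_div_mul_prod_le`, `norm_truncMultiplier_le`). Bounding absolute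
values instead would cost a factor `|ξ|` near `y = 0`, that is, an extra derivative of `g`.

The uniform bound lets `ε → 0` under the frequency integral and under the series, which gives the
principal value together with its Fourier density (`hasPrincipalValue_selfKernel`). The weighted
norm then follows from `|ξ + ∑ ωⱼ|^s ≤ (p+1)^s (|ξ|^s + ∑ |ωⱼ|^s)`. Summing the `p+1` equal
contributions loses a factor `p+1`, which the `p+1` factors `1/2π` from Fourier inversion absorb.

If `‖g‖_1 ≥ 1`, the series is infinite and `‖g‖_{s+1}` is nonzero, so the right-hand side is `∞`. -/

/-! ### Fourier inversion in the normalization `e^{-ixξ}`. -/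

/-- The inverse Fourier integral `∫ V(ξ) e^{i x ξ} dξ`, without normalizing factor. -/
def waveInt (V : ℝ → ℂ) (x : ℝ) : ℂ :=
  ∫ ξ : ℝ, V ξ * Complex.exp (Complex.I * x * ξ)

theorem waveInt_eq_fourierInt_neg (V : ℝ → ℂ) (x : ℝ) : waveInt V x = fourierInt V (-x) := by
  simp only [waveInt, fourierInt]
  congr 1 with ξ
  congr 2
  push_cast
  ring

theorem continuous_fourierInt {f : ℝ → ℂ} (hf : Integrable f) : Continuous (fourierInt f) := by
  rw [fourierInt_eq_vectorFourier]
  exact VectorFourier.fourierIntegral_continuous Real.continuous_probChar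
    (by simpa using continuous_mul) hf

theorem continuous_waveInt {V : ℝ → ℂ} (hV : Integrable V) : Continuous (waveInt V) := by
  have h : waveInt V = fun x => fourierInt V (-x) := funext (waveInt_eq_fourierInt_neg V)
  rw [h]
  exact (continuous_fourierInt hV).comp continuous_neg

theorem norm_exp_I_mul_mul (x ξ : ℝ) : ‖Complex.exp (Complex.I * x * ξ)‖ = 1 := by
  rw [mul_assoc, mul_comm, ← Complex.ofReal_mul]
  exact Complex.norm_exp_ofReal_mul_I _

theorem norm_waveInt_le (V : ℝ → ℂ) (x : ℝ) : ‖waveInt V x‖ ≤ ∫ ξ, ‖V ξ‖ := by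
  refine (norm_integral_le_integral_norm _).trans_eq ?_
  simp_rw [norm_mul, norm_exp_I_mul_mul, mul_one]

theorem integral_fourierInt_mul {f g : ℝ → ℂ} (hf : Integrable f) (hg : Integrable g) :
    ∫ ξ, fourierInt f ξ * g ξ = ∫ x, f x * fourierInt g x := by
  have hc : Continuous fun p : ℝ × ℝ => LinearMap.mul ℝ ℝ p.1 p.2 := by
    simpa using continuous_mul
  have key := VectorFourier.integral_fourierIntegral_smul_eq_flip Real.continuous_probChar hc hf hg
  have hflip : (LinearMap.mul ℝ ℝ).flip = LinearMap.mul ℝ ℝ := by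
    ext
    simp
  rw [hflip, ← fourierInt_eq_vectorFourier, ← fourierInt_eq_vectorFourier] at key
  simpa only [smul_eq_mul] using key

theorem integral_waveInt_mul {f g : ℝ → ℂ} (hf : Integrable f) (hg : Integrable g) :
    ∫ ξ, waveInt f ξ * g ξ = ∫ x, f x * waveInt g x := by
  have h1 : ∫ ξ, waveInt f ξ * g ξ = ∫ ξ, fourierInt f ξ * g (-ξ) := by
    rw [← integral_neg_eq_self]
    simp_rw [waveInt_eq_fourierInt_neg, neg_neg]
  rw [h1, integral_fourierInt_mul hf hg.comp_neg]
  congr 1 with x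
  congr 1
  simp only [fourierInt, waveInt]
  rw [← integral_neg_eq_self]
  congr 1 with ξ
  rw [neg_neg]
  congr 2
  push_cast
  ring

theorem fourierInt_eq_fourier (f : ℝ → ℂ) (ξ : ℝ) : fourierInt f ξ = 𝓕 f (ξ / (2 * Real.pi)) := by
  rw [Real.fourier_real_eq_integral_exp_smul]
  simp only [fourierInt, smul_eq_mul]
  congr 1 with v
  rw [mul_comm]
  congr 2
  have : (Real.pi : ℂ) ≠ 0 := by exact_mod_cast Real.pi_ne_zero
  push_cast
  field_simp

theorem two_pi_ne_zero : 2 * Real.pi ≠ 0 := by positivity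

/-- Dilation of a Schwartz function. -/
def schwartzDilate (c : ℝ) (hc : c ≠ 0) (φ : 𝓢(ℝ, ℂ)) : 𝓢(ℝ, ℂ) :=
  SchwartzMap.compCLMOfContinuousLinearEquiv ℂ
    (ContinuousLinearEquiv.unitsEquivAut ℝ (Units.mk0 c hc)) φ

theorem schwartzDilate_apply (c : ℝ) (hc : c ≠ 0) (φ : 𝓢(ℝ, ℂ)) (x : ℝ) :
    schwartzDilate c hc φ x = φ (x * c) := rfl

theorem exists_schwartz_eq_fourierInt (φ : 𝓢(ℝ, ℂ)) : ∃ ψ : 𝓢(ℝ, ℂ), ⇑ψ = fourierInt φ := by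
  refine ⟨schwartzDilate (2 * Real.pi)⁻¹ (inv_ne_zero two_pi_ne_zero) (𝓕 φ), ?_⟩
  ext x
  rw [schwartzDilate_apply, fourierInt_eq_fourier, SchwartzMap.fourier_coe, div_eq_mul_inv]

theorem exists_schwartz_fourierInt_eq (ψ : 𝓢(ℝ, ℂ)) : ∃ φ : 𝓢(ℝ, ℂ), fourierInt φ = ⇑ψ := by
  refine ⟨𝓕⁻ (schwartzDilate (2 * Real.pi) two_pi_ne_zero ψ), ?_⟩
  ext x
  rw [fourierInt_eq_fourier, ← SchwartzMap.fourier_coe, FourierTransform.fourier_fourierInv_eq,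
    schwartzDilate_apply, div_mul_cancel₀ _ two_pi_ne_zero]

/-- Schwartz inversion for the kernel `e^{-2πixξ}`, rescaled; the substitution `ξ ↦ ξ / 2π` produces
the factor `2π`. -/
theorem waveInt_fourierInt (φ : 𝓢(ℝ, ℂ)) (x : ℝ) :
    waveInt (fourierInt φ) x = 2 * Real.pi * φ x := by
  have h1 : waveInt (fourierInt φ) x = ∫ ξ : ℝ, (fun u : ℝ =>
      Complex.exp (((2 * Real.pi * inner ℝ u x : ℝ) : ℂ) * Complex.I) • 𝓕 φ u)
        (ξ / (2 * Real.pi)) := by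
    simp only [waveInt]
    congr 1 with ξ
    rw [fourierInt_eq_fourier, SchwartzMap.fourier_coe, smul_eq_mul, mul_comm]
    congr 2
    have : (Real.pi : ℂ) ≠ 0 := by exact_mod_cast Real.pi_ne_zero
    simp
    field_simp
  rw [h1, Measure.integral_comp_div (fun u : ℝ =>
      Complex.exp (((2 * Real.pi * inner ℝ u x : ℝ) : ℂ) * Complex.I) • 𝓕 φ u),
    ← Real.fourierInv_eq', ← SchwartzMap.fourierInv_coe,
    FourierTransform.fourierInv_fourier_eq, abs_of_pos (by positivity)]
  simp

theorem integrable_waveInt_mul {V f : ℝ → ℂ} (hV : Integrable V) (hf : Integrable f) :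
    Integrable fun x => waveInt V x * f x :=
  hf.bdd_mul (continuous_waveInt hV).aestronglyMeasurable
    (Eventually.of_forall (norm_waveInt_le V))

theorem integrable_fourierInt (φ : 𝓢(ℝ, ℂ)) : Integrable (fourierInt φ) := by
  obtain ⟨ψ, hψ⟩ := exists_schwartz_eq_fourierInt φ
  rw [← hψ]
  exact ψ.integrable

theorem integral_waveInt_mul_fourierInt {V : ℝ → ℂ} (hV : Integrable V) (φ : 𝓢(ℝ, ℂ)) :
    ∫ x, waveInt V x * fourierInt φ x = 2 * Real.pi * ∫ ξ, V ξ * φ ξ := by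
  rw [integral_waveInt_mul hV (integrable_fourierInt φ), ← integral_const_mul]
  congr 1 with x
  rw [waveInt_fourierInt]
  ring

theorem integrable_mul_schwartz {V : ℝ → ℂ} (hV : Integrable V) (φ : 𝓢(ℝ, ℂ)) :
    Integrable fun ξ => V ξ * φ ξ := by
  obtain ⟨C, hC⟩ : ∃ C, ∀ x, ‖φ x‖ ≤ C :=
    ⟨_, fun x => φ.toBoundedContinuousFunction.norm_coe_le_norm x⟩
  exact hV.mul_bdd φ.continuous.aestronglyMeasurable (Eventually.of_forall hC)

theorem isFourierTransform_of_waveInt {u : ℝ → ℝ} {V : ℝ → ℂ} (hV : Integrable V)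
    (hu : ∀ x, (u x : ℂ) = waveInt V x) :
    IsFourierTransform u fun ξ => 2 * Real.pi * V ξ := by
  intro φ
  refine ⟨?_, ?_, ?_⟩
  · simp_rw [hu]
    exact integrable_waveInt_mul hV (integrable_fourierInt φ)
  · simpa only [mul_assoc] using ((integrable_mul_schwartz hV φ).const_mul (Real.pi : ℂ)).const_mul 2
  · simp_rw [hu, integral_waveInt_mul_fourierInt hV, ← integral_const_mul, mul_assoc]

/-! ### Uniqueness of the distributional Fourier transform, and the Wiener norm. -/

/-- Testing against a smooth bump that equals 1 on a ball gives integrability on that ball. -/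
theorem locallyIntegrable_of_integrable_mul_schwartz {f : ℝ → ℂ}
    (hf : ∀ φ : 𝓢(ℝ, ℂ), Integrable fun x => f x * φ x) : LocallyIntegrable f := by
  intro x
  let b : ContDiffBump x := ⟨1, 2, one_pos, one_lt_two⟩
  have hb : HasCompactSupport fun y => (b y : ℂ) :=
    b.hasCompactSupport.comp_left Complex.ofReal_zero
  have hs : ContDiff ℝ ((⊤ : ℕ∞) : WithTop ℕ∞) fun y => (b y : ℂ) :=
    Complex.ofRealCLM.contDiff.comp b.contDiff
  refine ⟨Metric.closedBall x 1, Metric.closedBall_mem_nhds x one_pos, ?_⟩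
  refine ((hf (hb.toSchwartzMap hs)).integrableOn (s := Metric.closedBall x 1)).congr_fun ?_
    Metric.isClosed_closedBall.measurableSet
  intro y hy
  have : b y = 1 := b.one_of_mem_closedBall hy
  simp [this]

theorem ae_eq_zero_of_integral_mul_schwartz {f : ℝ → ℂ}
    (hf : ∀ φ : 𝓢(ℝ, ℂ), Integrable fun x => f x * φ x)
    (h0 : ∀ φ : 𝓢(ℝ, ℂ), ∫ x, f x * φ x = 0) : ∀ᵐ x, f x = 0 := by
  refine ae_eq_zero_of_integral_contDiff_smul_eq_zero
    (locallyIntegrable_of_integrable_mul_schwartz hf) fun g hg hc => ?_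
  have hb : HasCompactSupport fun y => (g y : ℂ) := hc.comp_left Complex.ofReal_zero
  have hs : ContDiff ℝ ((⊤ : ℕ∞) : WithTop ℕ∞) fun y => (g y : ℂ) :=
    Complex.ofRealCLM.contDiff.comp hg
  rw [← h0 (hb.toSchwartzMap hs)]
  congr 1 with x
  simp [mul_comm]

theorem IsFourierTransform.ae_eq {u : ℝ → ℝ} {U V : ℝ → ℂ} (hU : IsFourierTransform u U)
    (hV : IsFourierTransform u V) : U =ᵐ[volume] V := by
  have : ∀ᵐ x, U x - V x = 0 := by
    refine ae_eq_zero_of_integral_mul_schwartz (fun φ => ?_) fun φ => ?_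
    · simpa only [sub_mul, Pi.sub_def] using (hU φ).2.1.sub (hV φ).2.1
    · simp_rw [sub_mul]
      rw [integral_sub (hU φ).2.1 (hV φ).2.1, (hU φ).2.2, (hV φ).2.2, sub_self]
  filter_upwards [this] with x hx using sub_eq_zero.1 hx

theorem wienerNorm_eq {u : ℝ → ℝ} {U : ℝ → ℂ} (hU : IsFourierTransform u U) (s : ℝ) :
    wienerNorm s u = ∫⁻ ξ : ℝ, ENNReal.ofReal (|ξ| ^ s) * ‖U ξ‖ₑ := by
  refine le_antisymm (iInf₂_le U hU) (le_iInf₂ fun V hV => le_of_eq ?_)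
  refine lintegral_congr_ae ?_
  filter_upwards [hU.ae_eq hV] with ξ h
  rw [h]

theorem exists_isFourierTransform_of_wienerNorm_lt_top {s : ℝ} {u : ℝ → ℝ}
    (h : wienerNorm s u < ∞) : ∃ U, IsFourierTransform u U := by
  by_contra! hU
  simp [wienerNorm, hU] at h

theorem IsFourierTransform.locallyIntegrable {u : ℝ → ℝ} {U : ℝ → ℂ}
    (hU : IsFourierTransform u U) : LocallyIntegrable U :=
  locallyIntegrable_of_integrable_mul_schwartz fun φ => (hU φ).2.1

theorem IsFourierTransform.integrable_rpow_mul {u : ℝ → ℝ} {U : ℝ → ℂ} {s : ℝ} (hs : 0 ≤ s)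
    (hU : IsFourierTransform u U) (h : wienerNorm s u < ∞) :
    Integrable fun ξ => |ξ| ^ s * ‖U ξ‖ := by
  rw [wienerNorm_eq hU] at h
  have hc : Continuous fun ξ : ℝ => |ξ| ^ s := continuous_abs.rpow_const fun _ => Or.inr hs
  refine ⟨hc.aestronglyMeasurable.mul hU.locallyIntegrable.aestronglyMeasurable.norm, ?_⟩
  rw [hasFiniteIntegral_iff_enorm]
  refine lt_of_eq_of_lt ?_ h
  congr 1 with ξ
  rw [enorm_mul, enorm_norm, Real.enorm_of_nonneg (by positivity)]

/-- Local integrability controls low frequencies; for `|ξ| ≥ 1` the weight `|ξ|` only helps. -/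
theorem IsFourierTransform.integrable {u : ℝ → ℝ} {U : ℝ → ℂ}
    (hU : IsFourierTransform u U) (h : wienerNorm 1 u < ∞) : Integrable U := by
  have h1 : IntegrableOn U (Set.Icc (-1) 1) :=
    hU.locallyIntegrable.integrableOn_isCompact isCompact_Icc
  have h2 : IntegrableOn U (Set.Icc (-1) 1)ᶜ := by
    refine Integrable.mono (hU.integrable_rpow_mul zero_le_one h).integrableOn
      hU.locallyIntegrable.aestronglyMeasurable.restrict ?_
    refine (ae_restrict_iff' measurableSet_Icc.compl).2 (Eventually.of_forall fun ξ hξ => ?_)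
    have : 1 ≤ |ξ| := by
      by_contra! h
      exact hξ (abs_le.1 h.le)
    rw [Real.norm_of_nonneg (by positivity), Real.rpow_one]
    exact le_mul_of_one_le_left (norm_nonneg _) this
  simpa using h1.union h2

/-- Every Schwartz function is a Fourier transform of one, so both sides agree as distributions,
hence almost everywhere, and by continuity everywhere. -/
theorem IsFourierTransform.eq_waveInt {u : ℝ → ℝ} {U : ℝ → ℂ} (hu : Continuous u)
    (hU : IsFourierTransform u U) (hi : Integrable U) (x : ℝ) :
    (u x : ℂ) = waveInt (fun ξ => (2 * Real.pi : ℂ)⁻¹ * U ξ) x := by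
  have hV : Integrable (fun ξ => (2 * Real.pi : ℂ)⁻¹ * U ξ) := hi.const_mul _
  have hp : (Real.pi : ℂ) ≠ 0 := by exact_mod_cast Real.pi_ne_zero
  have h1 : ∀ φ : 𝓢(ℝ, ℂ), Integrable fun x => (u x : ℂ) * φ x := fun φ => by
    obtain ⟨ψ, hψ⟩ := exists_schwartz_fourierInt_eq φ
    rw [← hψ]
    exact (hU ψ).1
  have h2 : ∀ φ : 𝓢(ℝ, ℂ), Integrable fun x =>
      waveInt (fun ξ => (2 * Real.pi : ℂ)⁻¹ * U ξ) x * φ x :=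
    fun φ => integrable_waveInt_mul hV φ.integrable
  have h3 : ∀ᵐ x, (u x : ℂ) - waveInt (fun ξ => (2 * Real.pi : ℂ)⁻¹ * U ξ) x = 0 := by
    refine ae_eq_zero_of_integral_mul_schwartz (fun φ => ?_) fun φ => ?_
    · simpa only [sub_mul, Pi.sub_def] using (h1 φ).sub (h2 φ)
    · simp_rw [sub_mul]
      rw [integral_sub (h1 φ) (h2 φ)]
      obtain ⟨ψ, hψ⟩ := exists_schwartz_fourierInt_eq φ
      rw [← hψ, integral_waveInt_mul_fourierInt hV, ← (hU ψ).2.2, ← integral_const_mul, sub_eq_zero]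
      congr 1 with ξ
      field_simp
  have h4 : (fun x => (u x : ℂ)) =ᵐ[volume] waveInt (fun ξ => (2 * Real.pi : ℂ)⁻¹ * U ξ) := by
    filter_upwards [h3] with x hx using sub_eq_zero.1 hx
  exact congrFun ((Continuous.ae_eq_iff_eq volume (by fun_prop) (continuous_waveInt hV)).1 h4) x

/-! ### The averaged exponential -/

/-- `avgExp z = ∫₀¹ e^{-i t z} dt`. -/
def avgExp (z : ℝ) : ℂ := ∫ t in (0 : ℝ)..1, Complex.exp (-(Complex.I * z * t))

theorem norm_exp_neg_I_mul_mul (x ξ : ℝ) : ‖Complex.exp (-(Complex.I * x * ξ))‖ = 1 := by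
  have := norm_exp_I_mul_mul (-x) ξ
  rwa [Complex.ofReal_neg, mul_neg, neg_mul] at this

theorem norm_exp_neg_I_mul (x : ℝ) : ‖Complex.exp (-(Complex.I * x))‖ = 1 := by
  simpa using norm_exp_neg_I_mul_mul x 1

theorem continuous_avgExp : Continuous avgExp := by
  unfold avgExp
  exact intervalIntegral.continuous_parametric_intervalIntegral_of_continuous'
    (by fun_prop) _ _

theorem norm_avgExp_le_one (z : ℝ) : ‖avgExp z‖ ≤ 1 := by
  have := intervalIntegral.norm_integral_le_of_norm_le_const
    (a := (0 : ℝ)) (b := 1) (C := 1) (f := fun t : ℝ => Complex.exp (-(Complex.I * z * t)))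
    fun t _ => (norm_exp_neg_I_mul_mul z t).le
  simpa [avgExp] using this

theorem I_mul_mul_avgExp (z : ℝ) :
    Complex.I * z * avgExp z = 1 - Complex.exp (-(Complex.I * z)) := by
  rcases eq_or_ne z 0 with rfl | hz
  · simp
  have hc : -(Complex.I * z) ≠ 0 := by simp [hz]
  have h := integral_exp_mul_complex (a := 0) (b := 1) hc
  simp only [neg_mul] at h
  rw [avgExp, h]
  have : (z : ℂ) ≠ 0 := by exact_mod_cast hz
  simp
  field_simp
  ring

theorem norm_one_sub_exp_le_two (z : ℝ) : ‖1 - Complex.exp (-(Complex.I * z))‖ ≤ 2 := by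
  refine (norm_sub_le _ _).trans ?_
  rw [norm_exp_neg_I_mul, norm_one]
  norm_num

theorem abs_mul_norm_avgExp (z : ℝ) :
    |z| * ‖avgExp z‖ = ‖1 - Complex.exp (-(Complex.I * z))‖ := by
  rw [← I_mul_mul_avgExp]
  simp

theorem abs_mul_norm_avgExp_le (z : ℝ) : |z| * ‖avgExp z‖ ≤ 2 :=
  (abs_mul_norm_avgExp z).trans_le (norm_one_sub_exp_le_two z)

theorem norm_one_sub_exp_le_abs (z : ℝ) : ‖1 - Complex.exp (-(Complex.I * z))‖ ≤ |z| := by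
  rw [← abs_mul_norm_avgExp]
  exact mul_le_of_le_one_right (abs_nonneg _) (norm_avgExp_le_one z)

/-! ### Truncated sine integrals -/

/-- Integration by parts: the boundary terms contribute at most `1/a + 1/b` and the remaining
integral at most `1/a - 1/b`. -/
theorem abs_integral_sin_div_le_of_one_le {a b : ℝ} (ha : 1 ≤ a) (hab : a ≤ b) :
    |∫ y in a..b, Real.sin y / y| ≤ 2 := by
  have hpos : ∀ y ∈ Set.uIcc a b, 0 < y := fun y hy => by
    rw [Set.uIcc_of_le hab] at hy
    linarith [hy.1]
  have hne : (0 : ℝ) ∉ Set.uIcc a b := fun h => (hpos 0 h).false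
  have hi2 : IntervalIntegrable (fun y : ℝ => (y ^ 2)⁻¹) volume a b :=
    (ContinuousOn.inv₀ (by fun_prop) fun y hy => (pow_pos (hpos y hy) 2).ne').intervalIntegrable
  have hparts := intervalIntegral.integral_mul_deriv_eq_deriv_mul (a := a) (b := b)
    (u := fun y : ℝ => y⁻¹) (v := fun y => -Real.cos y) (u' := fun y => -(y ^ 2)⁻¹)
    (v' := Real.sin)
    (fun y hy => hasDerivAt_inv (hpos y hy).ne')
    (fun y _ => by
      have := (Real.hasDerivAt_cos y).fun_neg
      rwa [neg_neg] at this) hi2.neg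
    (Real.continuous_sin.intervalIntegrable _ _)
  have h1 : ∫ y in a..b, Real.sin y / y = ∫ y in a..b, y⁻¹ * Real.sin y := by
    congr 1 with y
    rw [div_eq_inv_mul]
  have h2 : ∫ y in a..b, (y ^ 2)⁻¹ = a⁻¹ - b⁻¹ := by
    rw [intervalIntegral.integral_eq_sub_of_hasDerivAt (f := fun y : ℝ => -y⁻¹)
      (fun y hy => by
        have := (hasDerivAt_inv (hpos y hy).ne').fun_neg
        rwa [neg_neg] at this) hi2]
    ring
  have h3 : |∫ y in a..b, -(y ^ 2)⁻¹ * -Real.cos y| ≤ a⁻¹ - b⁻¹ := by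
    rw [← h2, ← Real.norm_eq_abs]
    refine intervalIntegral.norm_integral_le_of_norm_le hab (ae_of_all _ fun y _ => ?_) hi2
    rw [neg_mul_neg, norm_mul, Real.norm_of_nonneg (by positivity)]
    exact mul_le_of_le_one_right (by positivity) (Real.abs_cos_le_one y)
  rw [h1, hparts]
  have ha0 : 0 < a := by linarith
  have hb0 : 0 < b := by linarith
  have hai : a⁻¹ ≤ 1 := inv_le_one_of_one_le₀ ha
  have h4 : |b⁻¹ * -Real.cos b| ≤ b⁻¹ := by
    rw [abs_mul, abs_of_pos (inv_pos.2 hb0), abs_neg]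
    exact mul_le_of_le_one_right (by positivity) (Real.abs_cos_le_one b)
  have h5 : |a⁻¹ * -Real.cos a| ≤ a⁻¹ := by
    rw [abs_mul, abs_of_pos (inv_pos.2 ha0), abs_neg]
    exact mul_le_of_le_one_right (by positivity) (Real.abs_cos_le_one a)
  rw [abs_le] at *
  constructor <;> linarith [h3.1, h3.2, h4.1, h4.2, h5.1, h5.2]

theorem intervalIntegrable_sin_div {a b : ℝ} (ha : 0 < a) (hb : 0 < b) :
    IntervalIntegrable (fun y => Real.sin y / y) volume a b :=
  (ContinuousOn.div (by fun_prop) (by fun_prop) fun y hy =>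
    ((lt_min ha hb).trans_le hy.1).ne').intervalIntegrable

theorem abs_integral_sin_div_le_of_le_one {a b : ℝ} (ha : 0 < a) (hab : a ≤ b) (hb : b ≤ 1) :
    |∫ y in a..b, Real.sin y / y| ≤ 1 := by
  have := intervalIntegral.norm_integral_le_of_norm_le_const
    (a := a) (b := b) (C := 1) (f := fun y => Real.sin y / y) fun y _ => by
      rw [norm_div]
      exact div_le_one_of_le₀ Real.abs_sin_le_abs (norm_nonneg _)
  rw [Real.norm_eq_abs, abs_of_nonneg (sub_nonneg.2 hab)] at this
  linarith

theorem abs_integral_sin_div_le {a b : ℝ} (ha : 0 < a) (hab : a ≤ b) :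
    |∫ y in a..b, Real.sin y / y| ≤ 3 := by
  rcases le_total b 1 with hb | hb
  · linarith [abs_integral_sin_div_le_of_le_one ha hab hb]
  rcases le_total 1 a with h1 | h1
  · linarith [abs_integral_sin_div_le_of_one_le h1 hab]
  rw [← intervalIntegral.integral_add_adjacent_intervals
    (intervalIntegrable_sin_div ha one_pos) (intervalIntegrable_sin_div one_pos (by linarith))]
  refine (abs_add_le _ _).trans ?_
  linarith [abs_integral_sin_div_le_of_le_one ha h1 le_rfl,
    abs_integral_sin_div_le_of_one_le le_rfl hb]

/-- The measure `dy/y` is scale invariant, so the bound does not depend on `A`; negative `A` follows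
by oddness. -/
theorem abs_integral_sin_mul_div_le {a b : ℝ} (A : ℝ) (ha : 0 < a) (hab : a ≤ b) :
    |∫ y in a..b, Real.sin (A * y) / y| ≤ 3 := by
  have hA : ∀ A : ℝ, 0 < A → |∫ y in a..b, Real.sin (A * y) / y| ≤ 3 := fun A hA => by
    have h1 : ∫ y in a..b, Real.sin (A * y) / y = ∫ y in A * a..A * b, Real.sin y / y := by
      have h2 := intervalIntegral.integral_comp_mul_left (a := a) (b := b)
        (fun y => Real.sin y / y) hA.ne'
      rw [eq_inv_smul_iff₀ hA.ne', smul_eq_mul, ← intervalIntegral.integral_const_mul] at h2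
      rw [← h2]
      congr 1 with y
      field_simp
    rw [h1]
    exact abs_integral_sin_div_le (by positivity) (by gcongr)
  rcases lt_trichotomy A 0 with h | rfl | h
  · have := hA (-A) (by linarith)
    simpa [neg_div, intervalIntegral.integral_neg] using this
  · simp
  · exact hA A h

/-! ### Symmetric truncations -/

/-- The symmetric annulus `ε < |y| ≤ R`. -/
def annulus (ε R : ℝ) : Set ℝ := {y | ε < |y| ∧ |y| ≤ R}

theorem measurableSet_lt_abs (ε : ℝ) : MeasurableSet {y : ℝ | ε < |y|} :=
  measurableSet_lt measurable_const measurable_id.abs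

theorem measurableSet_annulus (ε R : ℝ) : MeasurableSet (annulus ε R) :=
  (measurableSet_lt_abs ε).inter (measurableSet_le measurable_id.abs measurable_const)

theorem annulus_subset_Icc (ε R : ℝ) : annulus ε R ⊆ Set.Icc (-R) R := fun _ hy => abs_le.1 hy.2

instance (ε R : ℝ) : IsFiniteMeasure (volume.restrict (annulus ε R)) :=
  ⟨by
    rw [Measure.restrict_apply_univ]
    exact (measure_mono (annulus_subset_Icc ε R)).trans_lt measure_Icc_lt_top⟩

theorem annulus_eq {ε R : ℝ} (hε : 0 < ε) :
    annulus ε R = Set.Ioc ε R ∪ Set.Ico (-R) (-ε) := by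
  ext y
  simp only [annulus, Set.mem_ofPred_eq, Set.mem_union, Set.mem_Ioc, Set.mem_Ico]
  rcases le_total 0 y with h | h
  · rw [abs_of_nonneg h]
    constructor
    · exact Or.inl
    · rintro (h | h)
      · exact h
      · linarith [h.2]
  · rw [abs_of_nonpos h]
    constructor
    · exact fun h => Or.inr ⟨by linarith [h.2], by linarith [h.1]⟩
    · rintro (h | h)
      · linarith [h.1]
      · exact ⟨by linarith [h.2], by linarith [h.1]⟩

theorem setIntegral_annulus {ε R : ℝ} (hε : 0 < ε) (hR : ε ≤ R) {f : ℝ → ℂ}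
    (hf : IntegrableOn f (annulus ε R)) :
    ∫ y in annulus ε R, f y = ∫ y in ε..R, (f y + f (-y)) := by
  rw [annulus_eq hε] at hf ⊢
  have hd : Disjoint (Set.Ioc ε R) (Set.Ico (-R) (-ε)) := by
    rw [Set.disjoint_left]
    intro y h1 h2
    linarith [h1.1, h2.2]
  have h2 : ∫ y in Set.Ico (-R) (-ε), f y = ∫ y in ε..R, f (-y) := by
    rw [intervalIntegral.integral_comp_neg, intervalIntegral.integral_of_le (by linarith),
      integral_Ico_eq_integral_Ioc]
  have hi1 : IntervalIntegrable f volume ε R :=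
    (intervalIntegrable_iff_integrableOn_Ioc_of_le hR).2 (hf.mono_set Set.subset_union_left)
  have hi2 : IntervalIntegrable (fun y => f (-y)) volume ε R := by
    rw [IntervalIntegrable.iff_comp_neg]
    simp_rw [neg_neg]
    refine IntervalIntegrable.symm ?_
    refine (intervalIntegrable_iff_integrableOn_Ico_of_le (by linarith)).2 ?_
    exact hf.mono_set Set.subset_union_right
  rw [setIntegral_union hd measurableSet_Ico (hf.mono_set Set.subset_union_left)
    (hf.mono_set Set.subset_union_right), h2, intervalIntegral.integral_add hi1 hi2,
    intervalIntegral.integral_of_le hR (f := f)]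

theorem integrableOn_annulus_div {ε R : ℝ} (hε : 0 < ε) {f : ℝ → ℂ} (hf : Measurable f)
    (hb : ∀ y, ‖f y‖ ≤ 1) : IntegrableOn (fun y => f y / y) (annulus ε R) := by
  refine Measure.integrableOn_of_bounded (M := ε⁻¹) ?_
    (hf.div (by fun_prop)).aestronglyMeasurable ?_
  · exact ((measure_mono (annulus_subset_Icc ε R)).trans_lt measure_Icc_lt_top).ne
  · refine (ae_restrict_iff' (measurableSet_annulus ε R)).2 (ae_of_all _ fun y hy => ?_)
    rw [norm_div, Complex.norm_real, div_eq_mul_inv, Real.norm_eq_abs, ← one_mul ε⁻¹]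
    exact mul_le_mul (hb y) (inv_anti₀ hε hy.1.le) (by positivity) zero_le_one

/-- On a symmetric set the odd part `cos(Ay)/y` cancels and only `-2i sin(Ay)/y` on the positive
half survives, hence `6 = 2 · 3`. -/
theorem norm_setIntegral_annulus_exp_div_le {ε R : ℝ} (hε : 0 < ε) (hR : ε ≤ R) (A : ℝ) :
    ‖∫ y in annulus ε R, Complex.exp (-(Complex.I * y * A)) / y‖ ≤ 6 := by
  rw [setIntegral_annulus hε hR (integrableOn_annulus_div hε (by fun_prop) fun y =>
    (norm_exp_neg_I_mul_mul y A).le)]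
  have h : ∀ y : ℝ, Complex.exp (-(Complex.I * y * A)) / y +
      Complex.exp (-(Complex.I * (-y : ℝ) * A)) / (-y : ℝ) =
        (-2 * Complex.I) * (Real.sin (A * y) / y : ℝ) := fun y => by
    push_cast
    rw [show -(Complex.I * y * A) = (-(A * y : ℂ)) * Complex.I by ring,
      show -(Complex.I * (-(y : ℂ)) * A) = (A * y : ℂ) * Complex.I by ring,
      Complex.exp_mul_I, Complex.exp_mul_I, Complex.cos_neg, Complex.sin_neg, div_neg]
    ring
  simp_rw [h]
  rw [intervalIntegral.integral_const_mul, intervalIntegral.integral_ofReal, norm_mul,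
    Complex.norm_real]
  have := abs_integral_sin_mul_div_le A hε hR
  simp
  linarith

/-! ### Oscillatory integrals with averaged exponentials. -/

section Multiplier

variable {ι : Type*}

theorem norm_prod_avgExp_le_one (S : Finset ι) (ω : ι → ℝ) (y : ℝ) :
    ‖∏ j ∈ S, avgExp (y * ω j)‖ ≤ 1 := by
  rw [norm_prod]
  exact Finset.prod_le_one (fun _ _ => norm_nonneg _) fun _ _ => norm_avgExp_le_one _

/-- Each factor `avgExp (y ω)` is the mean over `t ∈ [0,1]` of `e^{-iyωt}`, which merely shifts `A`
to `A + ωt`. Induction with `A` free therefore keeps the same constant for any number of factors.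
The two-sided truncation makes Fubini available. -/
theorem norm_setIntegral_annulus_exp_div_mul_prod_le {ε R : ℝ} (hε : 0 < ε) (hR : ε ≤ R)
    (S : Finset ι) (ω : ι → ℝ) (A : ℝ) :
    ‖∫ y in annulus ε R,
      Complex.exp (-(Complex.I * y * A)) / y * ∏ j ∈ S, avgExp (y * ω j)‖ ≤ 6 := by
  classical
  induction S using Finset.induction_on generalizing A with
  | empty => simpa using norm_setIntegral_annulus_exp_div_le hε hR A
  | insert i S hi ih =>
    have hm : Measurable avgExp := continuous_avgExp.measurable
    have h1 : ∀ y : ℝ, Complex.exp (-(Complex.I * y * A)) / y *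
        ∏ j ∈ insert i S, avgExp (y * ω j) =
        ∫ t in Set.Ioc (0 : ℝ) 1, Complex.exp (-(Complex.I * y * (A + ω i * t : ℝ))) / y *
          ∏ j ∈ S, avgExp (y * ω j) := fun y => by
      rw [integral_mul_const, Finset.prod_insert hi, ← mul_assoc]
      congr 1
      rw [avgExp, intervalIntegral.integral_of_le zero_le_one, ← integral_const_mul]
      congr 1 with t
      rw [div_mul_eq_mul_div, ← Complex.exp_add]
      congr 2
      push_cast
      ring
    simp_rw [h1]
    rw [integral_integral_swap]
    · refine (norm_integral_le_of_norm_le_const (C := 6) (ae_of_all _ fun t => ih _)).trans ?_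
      simp
    · have hb : ∀ᵐ p : ℝ × ℝ ∂(volume.restrict (annulus ε R)).prod
          (volume.restrict (Set.Ioc (0 : ℝ) 1)),
          ‖Complex.exp (-(Complex.I * p.1 * (A + ω i * p.2 : ℝ))) / p.1 *
            ∏ j ∈ S, avgExp (p.1 * ω j)‖ ≤ ε⁻¹ := by
        rw [Measure.prod_restrict]
        refine (ae_restrict_iff' ((measurableSet_annulus ε R).prod measurableSet_Ioc)).2
          (ae_of_all _ fun p hp => ?_)
        rw [norm_mul, norm_div, norm_exp_neg_I_mul_mul, ← mul_one ε⁻¹, one_div, Complex.norm_real]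
        exact mul_le_mul (inv_anti₀ hε hp.1.1.le) (norm_prod_avgExp_le_one _ _ _)
          (norm_nonneg _) (by positivity)
      refine Integrable.of_bound ?_ _ hb
      refine Measurable.aestronglyMeasurable ?_
      have : Measurable fun p : ℝ × ℝ => ∏ j ∈ S, avgExp (p.1 * ω j) :=
        Finset.measurable_prod _ fun j _ => hm.comp (by fun_prop)
      exact Measurable.mul (by fun_prop) this

/-! ### The multiplier -/

variable [Fintype ι]

/-- The integrand of the multiplier. -/
def pvSymbol (ξ : ℝ) (ω : ι → ℝ) (y : ℝ) : ℂ :=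
  (1 - Complex.exp (-(Complex.I * (y * ξ : ℝ)))) / y * ∏ j, avgExp (y * ω j)

theorem measurable_pvSymbol :
    Measurable fun p : (ℝ × (ι → ℝ)) × ℝ => pvSymbol p.1.1 p.1.2 p.2 := by
  have hm : Measurable avgExp := continuous_avgExp.measurable
  have : Measurable fun p : (ℝ × (ι → ℝ)) × ℝ => ∏ j, avgExp (p.2 * p.1.2 j) :=
    Finset.measurable_prod _ fun j _ => hm.comp (by fun_prop)
  unfold pvSymbol
  exact Measurable.mul (by fun_prop) this

theorem norm_pvSymbol_le_abs (ξ : ℝ) (ω : ι → ℝ) (y : ℝ) : ‖pvSymbol ξ ω y‖ ≤ |ξ| := by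
  rw [pvSymbol, norm_mul, norm_div, Complex.norm_real, Real.norm_eq_abs]
  refine (mul_le_of_le_one_right (by positivity) (norm_prod_avgExp_le_one _ _ _)).trans ?_
  refine div_le_of_le_mul₀ (abs_nonneg _) (abs_nonneg _) ?_
  rw [mul_comm |ξ|, ← abs_mul]
  exact norm_one_sub_exp_le_abs _

theorem norm_pvSymbol_le_div {ξ : ℝ} {ω : ι → ℝ} {y : ℝ} (hy : y ≠ 0) {i : ι} (hi : ω i ≠ 0) :
    ‖pvSymbol ξ ω y‖ ≤ 4 / |ω i| * (y ^ 2)⁻¹ := by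
  classical
  have hy' : 0 < |y| := abs_pos.2 hy
  have hi' : 0 < |ω i| := abs_pos.2 hi
  have h1 : ‖avgExp (y * ω i)‖ ≤ 2 / (|y| * |ω i|) := by
    rw [le_div_iff₀ (by positivity), mul_comm, ← abs_mul]
    exact abs_mul_norm_avgExp_le _
  rw [pvSymbol, ← Finset.mul_prod_erase _ _ (Finset.mem_univ i), norm_mul, norm_mul, norm_div,
    Complex.norm_real, Real.norm_eq_abs]
  calc _ ≤ 2 / |y| * (2 / (|y| * |ω i|) * 1) := by
        gcongr
        · exact norm_one_sub_exp_le_two _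
        · exact norm_prod_avgExp_le_one _ _ _
    _ = 4 / |ω i| * (y ^ 2)⁻¹ := by
        rw [← sq_abs y]
        field_simp
        norm_num

theorem integrable_pvSymbol {ξ : ℝ} {ω : ι → ℝ} {i : ι} (hi : ω i ≠ 0) :
    Integrable (pvSymbol ξ ω) := by
  have hi' : 0 < |ω i| := abs_pos.2 hi
  refine (integrable_inv_one_add_sq.const_mul (2 * (|ξ| + 4 / |ω i|))).mono' ?_
    (ae_of_all _ fun y => ?_)
  · exact (measurable_pvSymbol.comp (measurable_prodMk_left (x := (ξ, ω)))).aestronglyMeasurable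
  · rw [← div_eq_mul_inv, le_div_iff₀ (by positivity)]
    -- Use the bound `|ξ|` near the origin, where `1 + y² ≤ 2`, and the `y⁻²` decay elsewhere, where
    -- `1 + y² ≤ 2y²`.
    rcases le_total (y ^ 2) 1 with h | h
    · have := norm_pvSymbol_le_abs ξ ω y
      calc _ ≤ |ξ| * 2 := by gcongr; linarith
        _ ≤ _ := by nlinarith [show 0 < 4 / |ω i| by positivity]
    · have hy : y ≠ 0 := by
        rintro rfl
        norm_num at h
      have := norm_pvSymbol_le_div (ξ := ξ) hy hi
      calc _ ≤ 4 / |ω i| * (y ^ 2)⁻¹ * (2 * y ^ 2) := by gcongr; linarith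
        _ = 2 * (4 / |ω i|) := by field_simp
        _ ≤ _ := by nlinarith [abs_nonneg ξ]

/-- The symbol is the difference of the preceding integrands at `A = 0` and `A = ξ`, each
contributing 6. -/
theorem norm_setIntegral_annulus_pvSymbol_le {ε R : ℝ} (hε : 0 < ε) (hR : ε ≤ R)
    (ξ : ℝ) (ω : ι → ℝ) : ‖∫ y in annulus ε R, pvSymbol ξ ω y‖ ≤ 12 := by
  have hm : Measurable avgExp := continuous_avgExp.measurable
  have hi : ∀ A : ℝ, IntegrableOn (fun y : ℝ => Complex.exp (-(Complex.I * y * A)) / y *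
      ∏ j, avgExp (y * ω j)) (annulus ε R) := fun A => by
    have : Measurable fun y : ℝ => ∏ j, avgExp (y * ω j) :=
      Finset.measurable_prod _ fun j _ => hm.comp (by fun_prop)
    simp_rw [div_mul_eq_mul_div]
    refine integrableOn_annulus_div hε (Measurable.mul (by fun_prop) this) fun y => ?_
    rw [norm_mul, norm_exp_neg_I_mul_mul, one_mul]
    exact norm_prod_avgExp_le_one _ _ _
  have h : ∀ y, pvSymbol ξ ω y = Complex.exp (-(Complex.I * y * (0 : ℝ))) / y *
      ∏ j, avgExp (y * ω j) - Complex.exp (-(Complex.I * y * ξ)) / y *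
        ∏ j, avgExp (y * ω j) := fun y => by
    rw [← sub_mul, ← sub_div, pvSymbol]
    simp [mul_assoc]
  simp_rw [h]
  rw [integral_sub (hi 0) (hi ξ)]
  refine (norm_sub_le _ _).trans ?_
  linarith [norm_setIntegral_annulus_exp_div_mul_prod_le hε hR Finset.univ ω 0,
    norm_setIntegral_annulus_exp_div_mul_prod_le hε hR Finset.univ ω ξ]

/-- The multiplier truncated to `ε < |y|`. -/
def truncMultiplier (ε : ℝ) (p : ℝ × (ι → ℝ)) : ℂ := ∫ y in {y | ε < |y|}, pvSymbol p.1 p.2 y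

/-- The multiplier `∫ (1 - e^{-i y ξ}) / y ∏ⱼ avgExp (y ωⱼ) dy`. -/
def pvMultiplier (p : ℝ × (ι → ℝ)) : ℂ := ∫ y, pvSymbol p.1 p.2 y

theorem stronglyMeasurable_truncMultiplier (ε : ℝ) :
    StronglyMeasurable (truncMultiplier (ι := ι) ε) :=
  measurable_pvSymbol.stronglyMeasurable.integral_prod_right'

theorem stronglyMeasurable_pvMultiplier : StronglyMeasurable (pvMultiplier (ι := ι)) :=
  measurable_pvSymbol.stronglyMeasurable.integral_prod_right'

/-- The annulus bound is independent of the outer radius, which is sent to infinity. -/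
theorem norm_truncMultiplier_le {ε : ℝ} (hε : 0 < ε) (p : ℝ × (ι → ℝ)) :
    ‖truncMultiplier ε p‖ ≤ 12 := by
  by_cases hi : IntegrableOn (pvSymbol p.1 p.2) {y | ε < |y|}
  · have hU : (⋃ n : ℕ, annulus ε (ε + n)) = {y | ε < |y|} := by
      ext y
      simp only [annulus, Set.mem_iUnion, Set.mem_ofPred_eq, exists_and_left,
        and_iff_left_iff_imp]
      intro _
      obtain ⟨n, hn⟩ := exists_nat_ge |y|
      exact ⟨n, by linarith⟩
    have hmono : Monotone fun n : ℕ => annulus ε (ε + n) := fun n m hnm y hy =>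
      ⟨hy.1, hy.2.trans (by gcongr)⟩
    rw [← hU] at hi
    have ht := tendsto_setIntegral_of_monotone
      (fun n : ℕ => measurableSet_annulus ε (ε + n)) hmono hi
    rw [hU] at ht
    exact le_of_tendsto ht.norm (Eventually.of_forall fun n =>
      norm_setIntegral_annulus_pvSymbol_le hε (by simp) _ _)
  -- Without integrability the integral takes its default value 0, so the bound needs no restriction
  -- on the frequencies.
  · rw [truncMultiplier, integral_undef hi]
    simp

theorem tendsto_truncMultiplier {p : ℝ × (ι → ℝ)} {i : ι} (hi : p.2 i ≠ 0) :
    Tendsto (fun ε => truncMultiplier ε p) (𝓝[>] 0) (𝓝 (pvMultiplier p)) := by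
  have h := integrable_pvSymbol (ξ := p.1) hi
  unfold truncMultiplier pvMultiplier
  simp_rw [← integral_indicator (measurableSet_lt_abs _)]
  refine tendsto_integral_filter_of_dominated_convergence
    (fun y => ‖pvSymbol p.1 p.2 y‖) ?_ ?_ h.norm ?_
  · exact Eventually.of_forall fun ε => h.aestronglyMeasurable.indicator (measurableSet_lt_abs ε)
  · exact Eventually.of_forall fun ε => ae_of_all _ fun y => norm_indicator_le_norm_self _ _
  · have h0 : ∀ᵐ y : ℝ, y ≠ 0 := by simp [ae_iff]
    filter_upwards [h0] with y hy
    refine tendsto_const_nhds.congr' ?_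
    filter_upwards [Ioo_mem_nhdsGT (abs_pos.2 hy)] with ε hε
    simp [Set.indicator, hε.2]

theorem norm_pvMultiplier_le {p : ℝ × (ι → ℝ)} {i : ι} (hi : p.2 i ≠ 0) :
    ‖pvMultiplier p‖ ≤ 12 := by
  refine le_of_tendsto (tendsto_truncMultiplier hi).norm ?_
  filter_upwards [self_mem_nhdsWithin] with ε hε using norm_truncMultiplier_le hε p

end Multiplier

/-! ### Push-forward of densities along a shear -/

section Shear

variable {Ω : Type*} [MeasurableSpace Ω] {μ : Measure Ω} [SFinite μ] {τ : Ω → ℝ} {F : ℝ × Ω → ℂ}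

theorem measurePreserving_shear (hτ : Measurable τ) :
    MeasurePreserving (fun q : ℝ × Ω => (q.1 - τ q.2, q.2)) (volume.prod μ) (volume.prod μ) := by
  have h1 : MeasurePreserving (fun q : Ω × ℝ => (q.1, q.2 - τ q.1)) (μ.prod volume)
      (μ.prod volume) :=
    (MeasurePreserving.id μ).skew_product (g := fun ω ξ => ξ - τ ω) (by fun_prop)
      (ae_of_all _ fun ω => (measurePreserving_sub_right volume (τ ω)).map_eq)
  exact (Measure.measurePreserving_swap.comp h1).comp Measure.measurePreserving_swap

/-- The density of the push-forward of `F dξ dμ` under `(ξ, ω) ↦ ξ + τ ω`. -/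
def shearDensity (μ : Measure Ω) (τ : Ω → ℝ) (F : ℝ × Ω → ℂ) (η : ℝ) : ℂ :=
  ∫ ω, F (η - τ ω, ω) ∂μ

theorem integrable_shear (hτ : Measurable τ) (hF : Integrable F (volume.prod μ)) :
    Integrable (fun q : ℝ × Ω => F (q.1 - τ q.2, q.2)) (volume.prod μ) :=
  (measurePreserving_shear hτ).integrable_comp_of_integrable hF

theorem integrable_shearDensity (hτ : Measurable τ) (hF : Integrable F (volume.prod μ)) :
    Integrable (shearDensity μ τ F) :=
  (integrable_shear hτ hF).integral_prod_left

theorem waveInt_shearDensity (hτ : Measurable τ) (hF : Integrable F (volume.prod μ)) (x : ℝ) :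
    waveInt (shearDensity μ τ F) x =
      ∫ q, F q * Complex.exp (Complex.I * x * (q.1 + τ q.2 : ℝ)) ∂(volume.prod μ) := by
  have hm := measurePreserving_shear (μ := μ) hτ
  have hi : Integrable (fun q : ℝ × Ω => F (q.1 - τ q.2, q.2) *
      Complex.exp (Complex.I * x * q.1)) (volume.prod μ) :=
    (integrable_shear hτ hF).mul_bdd (c := 1)
      (Measurable.aestronglyMeasurable (by fun_prop))
      (ae_of_all _ fun q => (norm_exp_I_mul_mul x q.1).le)
  have he : AEStronglyMeasurable (fun q : ℝ × Ω => F q *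
      Complex.exp (Complex.I * x * (q.1 + τ q.2 : ℝ))) (volume.prod μ) :=
    hF.aestronglyMeasurable.mul (Measurable.aestronglyMeasurable (by fun_prop))
  simp_rw [waveInt, shearDensity, ← integral_mul_const]
  rw [← integral_prod _ hi]
  nth_rw 2 [← hm.map_eq]
  rw [integral_map hm.aemeasurable (by rwa [hm.map_eq])]
  simp

/-- Triangle inequality and Tonelli, followed by the measure-preserving shear, which moves the
weight to the total frequency. -/
theorem lintegral_mul_enorm_shearDensity_le (hτ : Measurable τ)
    (hF : Integrable F (volume.prod μ)) {w : ℝ → ℝ≥0∞} (hw : Measurable w)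
    (hw' : ∀ η, w η ≠ ∞) :
    ∫⁻ η, w η * ‖shearDensity μ τ F η‖ₑ ≤ ∫⁻ q, w (q.1 + τ q.2) * ‖F q‖ₑ ∂(volume.prod μ) := by
  have hm := measurePreserving_shear (μ := μ) hτ
  have he : AEMeasurable (fun q : ℝ × Ω => w (q.1 + τ q.2) * ‖F q‖ₑ) (volume.prod μ) :=
    AEMeasurable.mul (by fun_prop) hF.aestronglyMeasurable.enorm
  calc ∫⁻ η, w η * ‖shearDensity μ τ F η‖ₑ
      ≤ ∫⁻ η, ∫⁻ ω, w η * ‖F (η - τ ω, ω)‖ₑ ∂μ := by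
        refine lintegral_mono fun η => ?_
        rw [lintegral_const_mul' _ _ (hw' η)]
        gcongr
        exact enorm_integral_le_lintegral_enorm _
    _ = ∫⁻ q : ℝ × Ω, w q.1 * ‖F (q.1 - τ q.2, q.2)‖ₑ ∂(volume.prod μ) :=
        (lintegral_prod (fun q : ℝ × Ω => w q.1 * ‖F (q.1 - τ q.2, q.2)‖ₑ)
          (AEMeasurable.mul (by fun_prop) (integrable_shear hτ hF).aestronglyMeasurable.enorm)).symm
    _ = _ := by
        nth_rw 2 [← hm.map_eq]
        rw [lintegral_map' (by rwa [hm.map_eq]) hm.aemeasurable]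
        simp

end Shear

/-! ### Products of difference quotients -/

/-- The complex difference quotient. -/
def complexDiffQuot (f : ℝ → ℂ) (y x : ℝ) : ℂ := (f x - f (x - y)) / y

theorem integrable_mul_exp {V : ℝ → ℂ} (hV : Integrable V) (x : ℝ) :
    Integrable fun ξ : ℝ => V ξ * Complex.exp (Complex.I * x * ξ) :=
  hV.mul_bdd (c := 1) (Continuous.aestronglyMeasurable (by fun_prop))
    (ae_of_all _ fun ξ => (norm_exp_I_mul_mul x ξ).le)

theorem complexDiffQuot_waveInt {V : ℝ → ℂ} (hV : Integrable V) (y x : ℝ) :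
    complexDiffQuot (waveInt V) y x =
      ∫ ξ : ℝ, V ξ * Complex.exp (Complex.I * x * ξ) *
        ((1 - Complex.exp (-(Complex.I * (y * ξ : ℝ)))) / y) := by
  rw [complexDiffQuot, waveInt, waveInt, ← integral_sub (integrable_mul_exp hV x)
    (integrable_mul_exp hV (x - y)), ← integral_div]
  congr 1 with ξ
  rw [mul_div_assoc', mul_one_sub, mul_assoc _ (Complex.exp _) (Complex.exp _), ← Complex.exp_add]
  congr 4
  push_cast
  ring

theorem complexDiffQuot_waveInt_eq_avgExp {V h : ℝ → ℂ} (hV : Integrable V)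
    (hh : ∀ ξ : ℝ, h ξ = Complex.I * ξ * V ξ) {y : ℝ} (hy : y ≠ 0) (x : ℝ) :
    complexDiffQuot (waveInt V) y x =
      ∫ ξ : ℝ, h ξ * Complex.exp (Complex.I * x * ξ) * avgExp (y * ξ) := by
  have hy' : (y : ℂ) ≠ 0 := by exact_mod_cast hy
  rw [complexDiffQuot_waveInt hV]
  congr 1 with ξ
  rw [← I_mul_mul_avgExp, hh]
  push_cast
  field_simp

/-- The tensor power `h(ξ) ∏ⱼ h(ωⱼ)`. -/
def tensorPow (h : ℝ → ℂ) (p : ℕ) (q : ℝ × (Fin p → ℝ)) : ℂ := h q.1 * ∏ j, h (q.2 j)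

theorem integrable_tensorPow {h : ℝ → ℂ} (hi : Integrable h) (p : ℕ) :
    Integrable (tensorPow h p) :=
  hi.mul_prod (Integrable.fintype_prod fun _ => hi)

theorem integral_norm_tensorPow (h : ℝ → ℂ) (p : ℕ) :
    ∫ q, ‖tensorPow h p q‖ = (∫ ξ, ‖h ξ‖) ^ (p + 1) := by
  simp_rw [tensorPow, norm_mul, norm_prod]
  rw [Measure.volume_eq_prod, integral_prod_mul (fun ξ => ‖h ξ‖)
      (fun ω : Fin p → ℝ => ∏ j, ‖h (ω j)‖),
    integral_fintype_prod_volume_eq_pow (fun ξ => ‖h ξ‖), Fintype.card_fin, pow_succ, mul_comm]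

/-- The powers of `Δ_y g` use `avgExp`, which turns `V` into `h`. The factor from `g'` keeps `(1 -
e^{-iyξ})/y`, since `ξ h(ξ)` need not be integrable. -/
theorem complexDiffQuot_mul_pow {V h : ℝ → ℂ} (hV : Integrable V) (hi : Integrable h)
    (hh : ∀ ξ : ℝ, h ξ = Complex.I * ξ * V ξ) {y : ℝ} (hy : y ≠ 0) (x : ℝ) (p : ℕ) :
    complexDiffQuot (waveInt h) y x * complexDiffQuot (waveInt V) y x ^ p =
      ∫ q : ℝ × (Fin p → ℝ), tensorPow h p q *
        Complex.exp (Complex.I * x * (q.1 + ∑ j, q.2 j : ℝ)) * pvSymbol q.1 q.2 y := by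
  have h1 := integral_fintype_prod_volume_eq_pow (ι := Fin p)
    (fun ξ : ℝ => h ξ * Complex.exp (Complex.I * x * ξ) * avgExp (y * ξ))
  rw [Fintype.card_fin] at h1
  rw [complexDiffQuot_waveInt hi, complexDiffQuot_waveInt_eq_avgExp hV hh hy, ← h1,
    ← integral_prod_mul, ← Measure.volume_eq_prod]
  congr 1 with q
  have h2 : Complex.exp (Complex.I * x * (q.1 + ∑ j, q.2 j : ℝ)) =
      Complex.exp (Complex.I * x * q.1) * ∏ j, Complex.exp (Complex.I * x * q.2 j) := by
    rw [← Complex.exp_sum, ← Complex.exp_add, ← Finset.mul_sum, ← mul_add]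
    push_cast
    rfl
  rw [h2, tensorPow, pvSymbol, Finset.prod_mul_distrib, Finset.prod_mul_distrib]
  ring

theorem integrableOn_inv_sq {ε : ℝ} (hε : 0 < ε) :
    IntegrableOn (fun y : ℝ => (y ^ 2)⁻¹) {y | ε < |y|} := by
  refine Integrable.mono' (integrable_inv_one_add_sq.const_mul (1 + (ε ^ 2)⁻¹)).integrableOn
    (Measurable.aestronglyMeasurable (by fun_prop)) ?_
  refine (ae_restrict_iff' (measurableSet_lt_abs ε)).2 (ae_of_all _ fun y hy => ?_)
  have hy : ε < |y| := hy
  have h1 : ε ^ 2 ≤ y ^ 2 := by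
    rw [← sq_abs y]
    gcongr
  have h2 : 0 < y ^ 2 := (by positivity : 0 < ε ^ 2).trans_le h1
  rw [Real.norm_of_nonneg (by positivity), ← div_eq_mul_inv, le_div_iff₀ (by positivity)]
  calc (y ^ 2)⁻¹ * (1 + y ^ 2) = 1 + (y ^ 2)⁻¹ := by
        rw [mul_add, inv_mul_cancel₀ h2.ne', mul_one, add_comm]
    _ ≤ _ := by gcongr

/-- One factor `avgExp (y ωᵢ)` supplies the decay `y⁻²` at the price of `1/|ωᵢ|`; this is affordable
because `|h(ωᵢ)|/|ωᵢ| = |V(ωᵢ)|` away from 0 and `V` is integrable. -/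
theorem integrable_tensorPow_mul_pvSymbol {V h : ℝ → ℂ} (hV : Integrable V) (hi : Integrable h)
    (hh : ∀ ξ : ℝ, h ξ = Complex.I * ξ * V ξ) {ε : ℝ} (hε : 0 < ε) (x : ℝ) {p : ℕ} (i : Fin p) :
    Integrable (fun r : (ℝ × (Fin p → ℝ)) × ℝ => tensorPow h p r.1 *
      Complex.exp (Complex.I * x * (r.1.1 + ∑ j, r.1.2 j : ℝ)) * pvSymbol r.1.1 r.1.2 r.2)
      (volume.prod (volume.restrict {y | ε < |y|})) := by
  -- The dominating tensor product has `4V` in place of `h` in slot `i`; the 4 comes from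
  -- `norm_pvSymbol_le_div`.
  let b : Fin p → ℝ → ℂ := fun j => if j = i then fun ξ => 4 * V ξ else h
  have hb : Integrable fun q : ℝ × (Fin p → ℝ) => h q.1 * ∏ j, b j (q.2 j) := by
    refine hi.mul_prod (Integrable.fintype_prod fun j => ?_)
    by_cases hj : j = i
    · simpa only [b, hj, if_true] using hV.const_mul 4
    · simpa only [b, hj, if_false] using hi
  refine Integrable.mono' (hb.norm.mul_prod (integrableOn_inv_sq hε)) ?_ ?_
  · refine AEStronglyMeasurable.mul (AEStronglyMeasurable.mul ?_ ?_) ?_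
    · exact (integrable_tensorPow hi p).aestronglyMeasurable.comp_fst
    · exact Measurable.aestronglyMeasurable (by fun_prop)
    · exact measurable_pvSymbol.aestronglyMeasurable
  · have hae : ∀ᵐ r : (ℝ × (Fin p → ℝ)) × ℝ ∂(volume.prod (volume.restrict {y | ε < |y|})),
        ε < |r.2| := by
      exact Measure.quasiMeasurePreserving_snd.ae (p := fun y : ℝ => ε < |y|)
        (ae_restrict_mem (measurableSet_lt_abs ε))
    filter_upwards [hae] with r hr
    have hy : r.2 ≠ 0 := abs_pos.1 (hε.trans hr)
    have hprod : ∏ j ∈ Finset.univ.erase i, b j (r.1.2 j) =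
        ∏ j ∈ Finset.univ.erase i, h (r.1.2 j) := Finset.prod_congr rfl fun j hj => by
      simp only [b, Finset.ne_of_mem_erase hj, if_false]
    rw [norm_mul, norm_mul, norm_exp_I_mul_mul, mul_one, tensorPow,
      ← Finset.mul_prod_erase _ _ (Finset.mem_univ i),
      ← Finset.mul_prod_erase _ _ (Finset.mem_univ i), hprod]
    simp only [b, if_true]
    have key : ‖h (r.1.2 i)‖ * ‖pvSymbol r.1.1 r.1.2 r.2‖ ≤
        ‖4 * V (r.1.2 i)‖ * (r.2 ^ 2)⁻¹ := by
      rcases eq_or_ne (r.1.2 i) 0 with h0 | h0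
      · rw [hh, h0]
        simp
        positivity
      · have h0' : 0 < |r.1.2 i| := abs_pos.2 h0
        calc _ ≤ ‖h (r.1.2 i)‖ * (4 / |r.1.2 i| * (r.2 ^ 2)⁻¹) := by
              gcongr
              exact norm_pvSymbol_le_div hy h0
          _ = _ := by
              rw [hh]
              simp
              field_simp
    simp only [norm_mul] at key ⊢
    calc _ = ‖h r.1.1‖ * ‖∏ j ∈ Finset.univ.erase i, h (r.1.2 j)‖ *
          (‖h (r.1.2 i)‖ * ‖pvSymbol r.1.1 r.1.2 r.2‖) := by ring
      _ ≤ ‖h r.1.1‖ * ‖∏ j ∈ Finset.univ.erase i, h (r.1.2 j)‖ *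
          (‖(4 : ℂ)‖ * ‖V (r.1.2 i)‖ * (r.2 ^ 2)⁻¹) := by gcongr
      _ = _ := by ring

theorem setIntegral_complexDiffQuot_mul_pow {V h : ℝ → ℂ} (hV : Integrable V)
    (hi : Integrable h) (hh : ∀ ξ : ℝ, h ξ = Complex.I * ξ * V ξ) {ε : ℝ} (hε : 0 < ε) (x : ℝ)
    {p : ℕ} (i : Fin p) :
    ∫ y in {y | ε < |y|},
        complexDiffQuot (waveInt h) y x * complexDiffQuot (waveInt V) y x ^ p =
      ∫ q : ℝ × (Fin p → ℝ), tensorPow h p q *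
        Complex.exp (Complex.I * x * (q.1 + ∑ j, q.2 j : ℝ)) * truncMultiplier ε q := by
  have h1 : ∫ y in {y | ε < |y|},
      complexDiffQuot (waveInt h) y x * complexDiffQuot (waveInt V) y x ^ p =
      ∫ y in {y | ε < |y|}, ∫ q : ℝ × (Fin p → ℝ), tensorPow h p q *
        Complex.exp (Complex.I * x * (q.1 + ∑ j, q.2 j : ℝ)) * pvSymbol q.1 q.2 y :=
    setIntegral_congr_fun (measurableSet_lt_abs ε) fun y hy =>
      complexDiffQuot_mul_pow hV hi hh (abs_pos.1 (hε.trans hy)) x p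
  rw [h1, integral_integral_swap]
  swap
  · exact (integrable_tensorPow_mul_pvSymbol hV hi hh hε x i).swap
  simp_rw [integral_const_mul, truncMultiplier]

/-- The Fourier density of the principal value of `Δ_y g' (Δ_y g)^p`. -/
def pvDensity (h : ℝ → ℂ) (p : ℕ) : ℝ → ℂ :=
  shearDensity volume (fun ω : Fin p → ℝ => ∑ j, ω j) fun q => tensorPow h p q * pvMultiplier q

/-- The multiplier bound requires some `ωᵢ ≠ 0`; where `ωᵢ = 0` the amplitude vanishes because `h 0
= 0`. -/
theorem norm_tensorPow_mul_pvMultiplier_le {h : ℝ → ℂ} (h0 : h 0 = 0) {p : ℕ} (i : Fin p)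
    (q : ℝ × (Fin p → ℝ)) : ‖tensorPow h p q * pvMultiplier q‖ ≤ 12 * ‖tensorPow h p q‖ := by
  rcases eq_or_ne (q.2 i) 0 with hq | hq
  · have : tensorPow h p q = 0 := by
      rw [tensorPow, Finset.prod_eq_zero (Finset.mem_univ i) (by rw [hq, h0]), mul_zero]
    simp [this]
  · rw [norm_mul, mul_comm]
    gcongr
    exact norm_pvMultiplier_le hq

theorem integrable_tensorPow_mul_pvMultiplier {h : ℝ → ℂ} (hi : Integrable h) (h0 : h 0 = 0)
    {p : ℕ} (i : Fin p) : Integrable fun q => tensorPow h p q * pvMultiplier q := by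
  have ht := integrable_tensorPow hi p
  exact (ht.norm.const_mul 12).mono'
    (ht.aestronglyMeasurable.mul stronglyMeasurable_pvMultiplier.aestronglyMeasurable)
    (ae_of_all _ (norm_tensorPow_mul_pvMultiplier_le h0 i))

theorem integrable_pvDensity {h : ℝ → ℂ} (hi : Integrable h) (h0 : h 0 = 0)
    {p : ℕ} (i : Fin p) : Integrable (pvDensity h p) :=
  integrable_shearDensity (by fun_prop) (integrable_tensorPow_mul_pvMultiplier hi h0 i)

theorem norm_setIntegral_complexDiffQuot_mul_pow_le {V h : ℝ → ℂ} (hV : Integrable V)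
    (hi : Integrable h) (hh : ∀ ξ : ℝ, h ξ = Complex.I * ξ * V ξ) {ε : ℝ} (hε : 0 < ε) (x : ℝ)
    {p : ℕ} (i : Fin p) :
    ‖∫ y in {y | ε < |y|},
        complexDiffQuot (waveInt h) y x * complexDiffQuot (waveInt V) y x ^ p‖ ≤
      12 * (∫ ξ, ‖h ξ‖) ^ (p + 1) := by
  rw [setIntegral_complexDiffQuot_mul_pow hV hi hh hε x i, ← integral_norm_tensorPow,
    ← integral_const_mul]
  refine norm_integral_le_of_norm_le ((integrable_tensorPow hi p).norm.const_mul 12)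
    (ae_of_all _ fun q => ?_)
  rw [norm_mul, norm_mul, norm_exp_I_mul_mul, mul_one, mul_comm]
  gcongr
  exact norm_truncMultiplier_le hε q

/-- Dominated convergence in frequency space: the truncated multipliers are bounded by 12 uniformly
in `ε`, so `12 ‖tensorPow h p‖` dominates. -/
theorem tendsto_setIntegral_complexDiffQuot_mul_pow {V h : ℝ → ℂ} (hV : Integrable V)
    (hi : Integrable h) (hh : ∀ ξ : ℝ, h ξ = Complex.I * ξ * V ξ) (x : ℝ) {p : ℕ} (i : Fin p) :
    Tendsto (fun ε : ℝ => ∫ y in {y | ε < |y|},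
        complexDiffQuot (waveInt h) y x * complexDiffQuot (waveInt V) y x ^ p)
      (𝓝[>] 0) (𝓝 (waveInt (pvDensity h p) x)) := by
  have h0 : h 0 = 0 := by simp [hh]
  have ht := integrable_tensorPow hi p
  rw [pvDensity, waveInt_shearDensity (by fun_prop) (integrable_tensorPow_mul_pvMultiplier hi h0 i)]
  have hlim : Tendsto (fun ε : ℝ => ∫ q : ℝ × (Fin p → ℝ), tensorPow h p q *
        Complex.exp (Complex.I * x * (q.1 + ∑ j, q.2 j : ℝ)) * truncMultiplier ε q) (𝓝[>] 0)
      (𝓝 (∫ q : ℝ × (Fin p → ℝ), tensorPow h p q * pvMultiplier q *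
        Complex.exp (Complex.I * x * (q.1 + ∑ j, q.2 j : ℝ)))) := by
    refine tendsto_integral_filter_of_dominated_convergence
      (fun q => 12 * ‖tensorPow h p q‖) ?_ ?_ (ht.norm.const_mul 12) ?_
    · refine Eventually.of_forall fun ε => ?_
      refine (ht.aestronglyMeasurable.mul ?_).mul
        (stronglyMeasurable_truncMultiplier ε).aestronglyMeasurable
      exact Continuous.aestronglyMeasurable (by fun_prop)
    · filter_upwards [self_mem_nhdsWithin] with ε hε
      refine ae_of_all _ fun q => ?_
      rw [norm_mul, norm_mul, norm_exp_I_mul_mul, mul_one, mul_comm]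
      gcongr
      exact norm_truncMultiplier_le hε q
    · refine ae_of_all _ fun q => ?_
      simp_rw [mul_right_comm _ (pvMultiplier q)]
      rcases eq_or_ne (q.2 i) 0 with hq | hq
      · have : tensorPow h p q = 0 := by
          rw [tensorPow, Finset.prod_eq_zero (Finset.mem_univ i) (by rw [hq, h0]), mul_zero]
        simp [this]
      · exact (tendsto_truncMultiplier hq).const_mul _
  refine hlim.congr' ?_
  filter_upwards [self_mem_nhdsWithin] with ε hε
  exact (setIntegral_complexDiffQuot_mul_pow hV hi hh hε x i).symm

/-! ### Expansion of the self-interaction kernel -/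

theorem integrable_tsum_of_tsum_lintegral_ne_top {f : ℕ → ℝ → ℂ} (hf : ∀ m, Integrable (f m))
    (h : ∑' m, ∫⁻ η, ‖f m η‖ₑ ≠ ∞) : Integrable fun η => ∑' m, f m η := by
  have hm : ∀ m, AEMeasurable (fun η => ‖f m η‖ₑ) := fun m => (hf m).aestronglyMeasurable.enorm
  rw [← lintegral_tsum hm] at h
  have hs : ∀ᵐ η, Summable fun m => f m η := by
    filter_upwards [ae_lt_top' (AEMeasurable.tsum hm) h] with η hη
    exact Summable.of_enorm hη.ne
  refine ⟨aestronglyMeasurable_of_tendsto_ae (u := atTop)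
    (f := fun n η => ∑ m ∈ Finset.range n, f m η) (fun n => ?_) ?_, ?_⟩
  · exact (integrable_finsetSum _ fun m _ => hf m).aestronglyMeasurable
  · filter_upwards [hs] with η hη using hη.hasSum.tendsto_sum_nat
  · rw [hasFiniteIntegral_iff_enorm]
    exact (lintegral_mono fun η => enorm_tsum_le_tsum_enorm).trans_lt h.lt_top

theorem hasDerivAt_waveInt {V h : ℝ → ℂ} (hV : Integrable V) (hi : Integrable h)
    (hh : ∀ ξ : ℝ, h ξ = Complex.I * ξ * V ξ) (x : ℝ) :
    HasDerivAt (waveInt V) (waveInt h x) x := by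
  refine (hasDerivAt_integral_of_dominated_loc_of_deriv_le (s := Set.univ)
    (F := fun (x : ℝ) (ξ : ℝ) => V ξ * Complex.exp (Complex.I * x * ξ))
    (F' := fun (x : ℝ) (ξ : ℝ) => h ξ * Complex.exp (Complex.I * x * ξ))
    (bound := fun ξ => ‖h ξ‖) univ_mem
    (Eventually.of_forall fun x => (integrable_mul_exp hV x).aestronglyMeasurable)
    (integrable_mul_exp hV x) (integrable_mul_exp hi x).aestronglyMeasurable ?_ hi.norm ?_).2
  · exact ae_of_all _ fun ξ x _ => by rw [norm_mul, norm_exp_I_mul_mul, mul_one]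
  · refine ae_of_all _ fun ξ x _ => ?_
    have h1 : HasDerivAt (fun x : ℝ => Complex.I * x * ξ) (Complex.I * 1 * ξ) x :=
      ((Complex.ofRealCLM.hasDerivAt (x := x)).const_mul Complex.I).mul_const (ξ : ℂ)
    refine ((h1.cexp).const_mul (V ξ)).congr_deriv ?_
    rw [hh]
    ring

section Kernel

variable {g : ℝ → ℝ} {V h : ℝ → ℂ}

theorem hasDerivAt_of_eq_waveInt (hV : Integrable V) (hi : Integrable h)
    (hh : ∀ ξ : ℝ, h ξ = Complex.I * ξ * V ξ) (hg : ∀ x, (g x : ℂ) = waveInt V x) (x : ℝ) :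
    HasDerivAt g (waveInt h x).re x ∧ ((waveInt h x).re : ℂ) = waveInt h x := by
  have h1 : HasDerivAt (fun x => (g x : ℂ)) (waveInt h x) x := by
    simp_rw [hg]
    exact hasDerivAt_waveInt hV hi hh x
  have h2 : HasDerivAt g (waveInt h x).re x := by
    exact Complex.reCLM.hasFDerivAt.comp_hasDerivAt x h1
  exact ⟨h2, h2.ofReal_comp.unique h1⟩

theorem ofReal_diffQuot (hg : ∀ x, (g x : ℂ) = waveInt V x) (y x : ℝ) :
    (diffQuot g y x : ℂ) = complexDiffQuot (waveInt V) y x := by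
  rw [diffQuot, complexDiffQuot, ← hg, ← hg]
  push_cast
  rfl

theorem ofReal_deriv_diffQuot (hV : Integrable V) (hi : Integrable h)
    (hh : ∀ ξ : ℝ, h ξ = Complex.I * ξ * V ξ) (hg : ∀ x, (g x : ℂ) = waveInt V x) (y x : ℝ) :
    ((deriv (diffQuot g y) x : ℝ) : ℂ) = complexDiffQuot (waveInt h) y x := by
  obtain ⟨h1, h1'⟩ := hasDerivAt_of_eq_waveInt hV hi hh hg x
  obtain ⟨h2, h2'⟩ := hasDerivAt_of_eq_waveInt hV hi hh hg (x - y)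
  have h3 : HasDerivAt (diffQuot g y)
      (((waveInt h x).re - (waveInt h (x - y)).re) / y) x :=
    (h1.sub (h2.comp_sub_const x y)).div_const y
  rw [h3.deriv, complexDiffQuot]
  push_cast
  rw [h1', h2']

theorem norm_complexDiffQuot_waveInt_le (V : ℝ → ℂ) (y x : ℝ) :
    ‖complexDiffQuot (waveInt V) y x‖ ≤ 2 * (∫ ξ, ‖V ξ‖) * |y|⁻¹ := by
  rw [complexDiffQuot, norm_div, Complex.norm_real, div_eq_mul_inv, Real.norm_eq_abs]
  gcongr
  refine (norm_sub_le _ _).trans ?_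
  linarith [norm_waveInt_le V x, norm_waveInt_le V (x - y)]

theorem norm_complexDiffQuot_waveInt_le_of_eq (hV : Integrable V) (hi : Integrable h)
    (hh : ∀ ξ : ℝ, h ξ = Complex.I * ξ * V ξ) (y x : ℝ) :
    ‖complexDiffQuot (waveInt V) y x‖ ≤ ∫ ξ, ‖h ξ‖ := by
  rcases eq_or_ne y 0 with rfl | hy
  · simp only [complexDiffQuot, Complex.ofReal_zero, div_zero, norm_zero]
    positivity
  · rw [complexDiffQuot_waveInt_eq_avgExp hV hh hy]
    refine norm_integral_le_of_norm_le hi.norm (ae_of_all _ fun ξ => ?_)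
    rw [norm_mul, norm_mul, norm_exp_I_mul_mul, mul_one]
    exact mul_le_of_le_one_right (norm_nonneg _) (norm_avgExp_le_one _)

theorem measurable_complexDiffQuot_waveInt (hV : Integrable V) (x : ℝ) :
    Measurable fun y => complexDiffQuot (waveInt V) y x := by
  have := (continuous_waveInt hV).measurable
  unfold complexDiffQuot
  fun_prop

theorem norm_complexDiffQuot_mul_le (V h : ℝ → ℂ) (y x : ℝ) :
    ‖complexDiffQuot (waveInt h) y x‖ * ‖complexDiffQuot (waveInt V) y x‖ ≤
      4 * (∫ ξ, ‖h ξ‖) * (∫ ξ, ‖V ξ‖) * (y ^ 2)⁻¹ := by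
  calc _ ≤ (2 * (∫ ξ, ‖h ξ‖) * |y|⁻¹) * (2 * (∫ ξ, ‖V ξ‖) * |y|⁻¹) := by
        gcongr
        · exact norm_complexDiffQuot_waveInt_le h y x
        · exact norm_complexDiffQuot_waveInt_le V y x
    _ = _ := by
        rw [← sq_abs y]
        ring

/-- One factor `Δ_y g` is paired with `Δ_y g'` to obtain `y⁻²`; the other `p` are bounded by `∫
‖h‖`, which gives geometric decay in `p`. -/
theorem integrableOn_complexDiffQuot_mul_pow (hV : Integrable V) (hi : Integrable h)
    (hh : ∀ ξ : ℝ, h ξ = Complex.I * ξ * V ξ) {ε : ℝ} (hε : 0 < ε) (x : ℝ) (p : ℕ) :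
    IntegrableOn (fun y => complexDiffQuot (waveInt h) y x *
      complexDiffQuot (waveInt V) y x ^ (p + 1)) {y | ε < |y|} ∧
    ∫ y in {y | ε < |y|}, ‖complexDiffQuot (waveInt h) y x *
      complexDiffQuot (waveInt V) y x ^ (p + 1)‖ ≤
        (∫ y in {y | ε < |y|}, 4 * (∫ ξ, ‖h ξ‖) * (∫ ξ, ‖V ξ‖) * (y ^ 2)⁻¹) *
          (∫ ξ, ‖h ξ‖) ^ p := by
  have hb : ∀ y, ‖complexDiffQuot (waveInt h) y x * complexDiffQuot (waveInt V) y x ^ (p + 1)‖ ≤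
      4 * (∫ ξ, ‖h ξ‖) * (∫ ξ, ‖V ξ‖) * (y ^ 2)⁻¹ * (∫ ξ, ‖h ξ‖) ^ p := fun y => by
    rw [norm_mul, norm_pow, pow_succ', ← mul_assoc]
    exact mul_le_mul (norm_complexDiffQuot_mul_le V h y x)
      (pow_le_pow_left₀ (norm_nonneg _) (norm_complexDiffQuot_waveInt_le_of_eq hV hi hh y x) p)
      (by positivity) (by positivity)
  have hI := ((integrableOn_inv_sq hε).const_mul
    (4 * (∫ ξ, ‖h ξ‖) * (∫ ξ, ‖V ξ‖))).mul_const ((∫ ξ, ‖h ξ‖) ^ p)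
  have hi' : IntegrableOn (fun y => complexDiffQuot (waveInt h) y x *
      complexDiffQuot (waveInt V) y x ^ (p + 1)) {y | ε < |y|} :=
    hI.mono' ((measurable_complexDiffQuot_waveInt hi x).mul
      ((measurable_complexDiffQuot_waveInt hV x).pow_const _)).aestronglyMeasurable (ae_of_all _ hb)
  refine ⟨hi', ?_⟩
  rw [← integral_mul_const]
  exact integral_mono hi'.norm hI hb

theorem hasSum_ofReal_selfKernel (hV : Integrable V) (hi : Integrable h)
    (hh : ∀ ξ : ℝ, h ξ = Complex.I * ξ * V ξ) (hg : ∀ x, (g x : ℂ) = waveInt V x)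
    (hlt : ∫ ξ, ‖h ξ‖ < 1) (x y : ℝ) :
    HasSum (fun m : ℕ => (-1 : ℂ) ^ m * (complexDiffQuot (waveInt h) y x *
      complexDiffQuot (waveInt V) y x ^ (2 * (m + 1)))) (selfKernel g x y : ℂ) := by
  have hq : ‖complexDiffQuot (waveInt V) y x‖ < 1 :=
    (norm_complexDiffQuot_waveInt_le_of_eq hV hi hh y x).trans_lt hlt
  have h1 : ‖-complexDiffQuot (waveInt V) y x ^ 2‖ < 1 := by
    rw [norm_neg, norm_pow]
    exact pow_lt_one₀ (norm_nonneg _) hq two_ne_zero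
  have h2 := (hasSum_geometric_of_norm_lt_one h1).mul_left
    (complexDiffQuot (waveInt h) y x * complexDiffQuot (waveInt V) y x ^ 2)
  have h3 : (selfKernel g x y : ℂ) = complexDiffQuot (waveInt h) y x *
      complexDiffQuot (waveInt V) y x ^ 2 * (1 - -complexDiffQuot (waveInt V) y x ^ 2)⁻¹ := by
    unfold selfKernel
    push_cast
    rw [ofReal_deriv_diffQuot hV hi hh hg, ofReal_diffQuot hg, sub_neg_eq_add, div_eq_mul_inv,
      mul_assoc]
  rw [h3]
  refine h2.congr_fun fun m => ?_
  rw [neg_pow (complexDiffQuot (waveInt V) y x ^ 2), ← pow_mul]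
  ring

theorem measurable_selfKernel (hV : Integrable V) (hi : Integrable h)
    (hh : ∀ ξ : ℝ, h ξ = Complex.I * ξ * V ξ) (hg : ∀ x, (g x : ℂ) = waveInt V x) (x : ℝ) :
    Measurable (selfKernel g x) := by
  have h1 : Measurable fun y => deriv (diffQuot g y) x := by
    have : (fun y => deriv (diffQuot g y) x) = fun y => (complexDiffQuot (waveInt h) y x).re := by
      funext y
      rw [← ofReal_deriv_diffQuot hV hi hh hg, Complex.ofReal_re]
    rw [this]
    exact Complex.measurable_re.comp (measurable_complexDiffQuot_waveInt hi x)
  have h2 : Measurable fun y => diffQuot g y x := by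
    have : (fun y => diffQuot g y x) = fun y => (complexDiffQuot (waveInt V) y x).re := by
      funext y
      rw [← ofReal_diffQuot hg, Complex.ofReal_re]
    rw [this]
    exact Complex.measurable_re.comp (measurable_complexDiffQuot_waveInt hV x)
  unfold selfKernel
  exact h1.mul ((h2.pow_const 2).div (measurable_const.add (h2.pow_const 2)))

theorem integrableOn_selfKernel (hV : Integrable V) (hi : Integrable h)
    (hh : ∀ ξ : ℝ, h ξ = Complex.I * ξ * V ξ) (hg : ∀ x, (g x : ℂ) = waveInt V x)
    {ε : ℝ} (hε : 0 < ε) (x : ℝ) : IntegrableOn (selfKernel g x) {y | ε < |y|} := by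
  refine ((integrableOn_inv_sq hε).const_mul (4 * (∫ ξ, ‖h ξ‖) * (∫ ξ, ‖V ξ‖))).mono'
    (measurable_selfKernel hV hi hh hg x).aestronglyMeasurable (ae_of_all _ fun y => ?_)
  refine le_trans ?_ (norm_complexDiffQuot_mul_le V h y x)
  rw [← ofReal_deriv_diffQuot hV hi hh hg, ← ofReal_diffQuot hg, Complex.norm_real,
    Complex.norm_real, selfKernel, norm_mul]
  gcongr
  rw [norm_div, Real.norm_of_nonneg (by positivity : 0 ≤ 1 + diffQuot g y x ^ 2), norm_pow,
    div_le_iff₀ (by positivity), Real.norm_eq_abs, ← sq_abs (diffQuot g y x)]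
  -- With `t = |Δ_y g|`, the claim `t² ≤ t(1 + t²)` follows from `t(1 + t²) - 2t² = t(t - 1)²`.
  nlinarith [abs_nonneg (diffQuot g y x), sq_nonneg (|diffQuot g y x| - 1)]

theorem summable_pow_two_mul_add {r : ℝ} (h0 : 0 ≤ r) (h1 : r < 1) (a : ℕ) :
    Summable fun m : ℕ => r ^ (2 * m + a) := by
  simp_rw [pow_add, pow_mul]
  exact (summable_geometric_of_lt_one (by positivity)
    (pow_lt_one₀ h0 h1 two_ne_zero)).mul_right _

theorem ofReal_setIntegral_selfKernel (hV : Integrable V) (hi : Integrable h)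
    (hh : ∀ ξ : ℝ, h ξ = Complex.I * ξ * V ξ) (hg : ∀ x, (g x : ℂ) = waveInt V x)
    (hlt : ∫ ξ, ‖h ξ‖ < 1) {ε : ℝ} (hε : 0 < ε) (x : ℝ) :
    ((∫ y in {y | ε < |y|}, selfKernel g x y : ℝ) : ℂ) =
      ∑' m : ℕ, (-1 : ℂ) ^ m * ∫ y in {y | ε < |y|}, complexDiffQuot (waveInt h) y x *
        complexDiffQuot (waveInt V) y x ^ (2 * (m + 1)) := by
  have hpos : 0 ≤ ∫ ξ, ‖h ξ‖ := by positivity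
  rw [← integral_complex_ofReal]
  simp_rw [← (hasSum_ofReal_selfKernel hV hi hh hg hlt x _).tsum_eq, ← integral_const_mul]
  refine (integral_tsum_of_summable_integral_norm (fun m => ?_) ?_).symm
  · exact (integrableOn_complexDiffQuot_mul_pow hV hi hh hε x (2 * m + 1)).1.const_mul _
  · refine Summable.of_nonneg_of_le (fun m => by positivity) (fun m => ?_)
      ((summable_pow_two_mul_add hpos hlt 1).mul_left
        (∫ y in {y | ε < |y|}, 4 * (∫ ξ, ‖h ξ‖) * (∫ ξ, ‖V ξ‖) * (y ^ 2)⁻¹))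
    simp_rw [norm_mul ((-1 : ℂ) ^ m), norm_pow, norm_neg, norm_one, one_pow, one_mul]
    exact (integrableOn_complexDiffQuot_mul_pow hV hi hh hε x (2 * m + 1)).2

/-- The Fourier density of the principal value of `∂ₓΔ_y g (Δ_y g)² / (1 + (Δ_y g)²)`. -/
def selfDensity (h : ℝ → ℂ) (η : ℝ) : ℂ := ∑' m : ℕ, (-1 : ℂ) ^ m * pvDensity h (2 * (m + 1)) η

theorem lintegral_enorm_pvDensity_le (hi : Integrable h) (h0 : h 0 = 0) {p : ℕ} (i : Fin p) :
    ∫⁻ η, ‖pvDensity h p η‖ₑ ≤ ENNReal.ofReal (12 * (∫ ξ, ‖h ξ‖) ^ (p + 1)) := by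
  have ht := integrable_tensorPow hi p
  have h1 := lintegral_mul_enorm_shearDensity_le (τ := fun ω : Fin p → ℝ => ∑ j, ω j)
    (by fun_prop) (integrable_tensorPow_mul_pvMultiplier hi h0 i) (w := fun _ => 1)
    measurable_const (fun _ => ENNReal.one_ne_top)
  simp only [one_mul] at h1
  refine h1.trans ?_
  rw [← integral_norm_tensorPow, ← integral_const_mul,
    ofReal_integral_eq_lintegral_ofReal (ht.norm.const_mul 12) (ae_of_all _ fun _ => by positivity)]
  refine lintegral_mono fun q => ?_
  rw [← ofReal_norm]
  exact ENNReal.ofReal_le_ofReal (norm_tensorPow_mul_pvMultiplier_le h0 i q)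

theorem tsum_lintegral_enorm_pvDensity_ne_top (hi : Integrable h) (h0 : h 0 = 0)
    (hlt : ∫ ξ, ‖h ξ‖ < 1) :
    ∑' m : ℕ, ∫⁻ η, ‖(-1 : ℂ) ^ m * pvDensity h (2 * (m + 1)) η‖ₑ ≠ ∞ := by
  have hpos : 0 ≤ ∫ ξ, ‖h ξ‖ := by positivity
  refine ne_top_of_le_ne_top ?_ (ENNReal.tsum_le_tsum
    (g := fun m => ENNReal.ofReal (12 * (∫ ξ, ‖h ξ‖) ^ (2 * m + 3))) fun m => ?_)
  · exact ((summable_pow_two_mul_add hpos hlt 3).mul_left 12).tsum_ofReal_ne_top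
  · simp_rw [enorm_mul, enorm_pow, enorm_neg, enorm_one, one_pow, one_mul]
    exact lintegral_enorm_pvDensity_le hi h0 (p := 2 * (m + 1)) ⟨0, by omega⟩

theorem integrable_neg_one_pow_mul_pvDensity (hi : Integrable h) (h0 : h 0 = 0) (m : ℕ) :
    Integrable fun η => (-1 : ℂ) ^ m * pvDensity h (2 * (m + 1)) η :=
  (integrable_pvDensity hi h0 ⟨0, by omega⟩).const_mul _

theorem integrable_selfDensity (hi : Integrable h) (h0 : h 0 = 0) (hlt : ∫ ξ, ‖h ξ‖ < 1) :
    Integrable (selfDensity h) :=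
  integrable_tsum_of_tsum_lintegral_ne_top (integrable_neg_one_pow_mul_pvDensity hi h0)
    (tsum_lintegral_enorm_pvDensity_ne_top hi h0 hlt)

theorem waveInt_selfDensity (hi : Integrable h) (h0 : h 0 = 0) (hlt : ∫ ξ, ‖h ξ‖ < 1) (x : ℝ) :
    waveInt (selfDensity h) x =
      ∑' m : ℕ, (-1 : ℂ) ^ m * waveInt (pvDensity h (2 * (m + 1))) x := by
  have he : ∀ ξ : ℝ, ‖Complex.exp (Complex.I * x * ξ)‖ₑ = 1 := fun ξ => by
    rw [← ofReal_norm, norm_exp_I_mul_mul, ENNReal.ofReal_one]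
  simp_rw [waveInt, selfDensity, ← tsum_mul_right, ← integral_const_mul, ← mul_assoc]
  refine integral_tsum (fun m => ?_) ?_
  · exact (integrable_mul_exp (integrable_neg_one_pow_mul_pvDensity hi h0 m) x).aestronglyMeasurable
  · simp_rw [enorm_mul _ (Complex.exp _), he, mul_one]
    exact tsum_lintegral_enorm_pvDensity_ne_top hi h0 hlt

/-- For fixed `ε` the series is integrated termwise; the majorant `12 (∫ ‖h‖)^(2m+3)` is independent
of `ε`, so the limit `ε → 0` passes through the sum. -/
theorem hasPrincipalValue_selfKernel (hV : Integrable V) (hi : Integrable h)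
    (hh : ∀ ξ : ℝ, h ξ = Complex.I * ξ * V ξ) (hg : ∀ x, (g x : ℂ) = waveInt V x)
    (hlt : ∫ ξ, ‖h ξ‖ < 1) (x : ℝ) :
    HasPrincipalValue (selfKernel g x) (principalValue (selfKernel g x)) ∧
      (principalValue (selfKernel g x) : ℂ) = waveInt (selfDensity h) x := by
  have h0 : h 0 = 0 := by simp [hh]
  have hpos : 0 ≤ ∫ ξ, ‖h ξ‖ := by positivity
  have h1 : Tendsto (fun ε : ℝ => ((∫ y in {y | ε < |y|}, selfKernel g x y : ℝ) : ℂ)) (𝓝[>] 0)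
      (𝓝 (waveInt (selfDensity h) x)) := by
    rw [waveInt_selfDensity hi h0 hlt]
    have h2 : Tendsto (fun ε : ℝ => ∑' m : ℕ, (-1 : ℂ) ^ m *
        ∫ y in {y | ε < |y|}, complexDiffQuot (waveInt h) y x *
          complexDiffQuot (waveInt V) y x ^ (2 * (m + 1))) (𝓝[>] 0)
        (𝓝 (∑' m : ℕ, (-1 : ℂ) ^ m * waveInt (pvDensity h (2 * (m + 1))) x)) := by
      refine tendsto_tsum_of_dominated_convergence
        ((summable_pow_two_mul_add hpos hlt 3).mul_left 12) (fun m => ?_) ?_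
      · exact (tendsto_setIntegral_complexDiffQuot_mul_pow hV hi hh x ⟨0, by omega⟩).const_mul _
      · filter_upwards [self_mem_nhdsWithin] with ε hε m
        rw [norm_mul, norm_pow, norm_neg, norm_one, one_pow, one_mul]
        exact norm_setIntegral_complexDiffQuot_mul_pow_le hV hi hh hε x
          (p := 2 * (m + 1)) ⟨0, by omega⟩
    refine h2.congr' ?_
    filter_upwards [self_mem_nhdsWithin] with ε hε
    exact (ofReal_setIntegral_selfKernel hV hi hh hg hlt hε x).symm
  have h2 : Tendsto (fun ε : ℝ => ∫ y in {y | ε < |y|}, selfKernel g x y) (𝓝[>] 0)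
      (𝓝 (waveInt (selfDensity h) x).re) := by
    exact (Complex.continuous_re.tendsto _).comp h1
  have h3 : principalValue (selfKernel g x) = (waveInt (selfDensity h) x).re := h2.limUnder_eq
  rw [h3]
  exact ⟨⟨fun ε hε => integrableOn_selfKernel hV hi hh hg hε x, h2⟩,
    tendsto_nhds_unique ((Complex.continuous_ofReal.tendsto _).comp h2) h1⟩

end Kernel

/-! ### Weighted norm of the density -/

/-- Comparison with the largest term works for every `s ≥ 0`, whereas convexity of the power would
need `s ≥ 1`. -/
theorem abs_sum_rpow_le {κ : Type*} [Fintype κ] [Nonempty κ] {s : ℝ} (hs : 0 ≤ s) (x : κ → ℝ) :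
    |∑ i, x i| ^ s ≤ (Fintype.card κ : ℝ) ^ s * ∑ i, |x i| ^ s := by
  obtain ⟨i, -, hi⟩ := Finset.exists_max_image Finset.univ (fun i => |x i|) Finset.univ_nonempty
  have h1 : |∑ i, x i| ≤ Fintype.card κ * |x i| := by
    refine (Finset.abs_sum_le_sum_abs _ _).trans ?_
    simpa using Finset.sum_le_card_nsmul Finset.univ (fun i => |x i|) _ hi
  calc |∑ i, x i| ^ s ≤ (Fintype.card κ * |x i|) ^ s := by gcongr
    _ = (Fintype.card κ : ℝ) ^ s * |x i| ^ s := Real.mul_rpow (by positivity) (abs_nonneg _)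
    _ ≤ _ := by
        gcongr
        exact Finset.single_le_sum (f := fun i => |x i| ^ s) (fun _ _ => by positivity)
          (Finset.mem_univ i)

theorem abs_add_sum_rpow_le {s : ℝ} (hs : 0 ≤ s) {p : ℕ} (ξ : ℝ) (ω : Fin p → ℝ) :
    |ξ + ∑ j, ω j| ^ s ≤ ((p : ℝ) + 1) ^ s * (|ξ| ^ s + ∑ j, |ω j| ^ s) := by
  have h := abs_sum_rpow_le hs (fun o : Option (Fin p) => o.elim ξ ω)
  simpa [Fintype.sum_option] using h

section Weighted

variable {h : ℝ → ℂ} {s : ℝ}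

theorem prod_ite_mul_norm (h : ℝ → ℂ) (s : ℝ) {p : ℕ} (i : Fin p) (ω : Fin p → ℝ) :
    ∏ j, (if j = i then fun ξ : ℝ => |ξ| ^ s * ‖h ξ‖ else fun ξ => ‖h ξ‖) (ω j) =
      |ω i| ^ s * ‖∏ j, h (ω j)‖ := by
  rw [norm_prod, ← Finset.mul_prod_erase _ _ (Finset.mem_univ i),
    ← Finset.mul_prod_erase _ (fun j => ‖h (ω j)‖) (Finset.mem_univ i), if_pos rfl, mul_assoc]
  congr 2
  exact Finset.prod_congr rfl fun j hj => by rw [if_neg (Finset.ne_of_mem_erase hj)]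

theorem integrable_rpow_mul_norm_prod (hi : Integrable h)
    (hs : Integrable fun ξ => |ξ| ^ s * ‖h ξ‖) {p : ℕ} (i : Fin p) :
    Integrable fun ω : Fin p → ℝ => |ω i| ^ s * ‖∏ j, h (ω j)‖ := by
  simp_rw [← prod_ite_mul_norm]
  refine Integrable.fintype_prod fun j => ?_
  by_cases hj : j = i
  · simpa only [hj, if_true] using hs
  · simpa only [hj, if_false] using hi.norm

theorem integral_rpow_mul_norm_prod (h : ℝ → ℂ) (s : ℝ) {p : ℕ} (i : Fin p) :
    ∫ ω : Fin p → ℝ, |ω i| ^ s * ‖∏ j, h (ω j)‖ =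
      (∫ ξ, |ξ| ^ s * ‖h ξ‖) * (∫ ξ, ‖h ξ‖) ^ (p - 1) := by
  simp_rw [← prod_ite_mul_norm]
  rw [integral_fintype_prod_volume_eq_prod, ← Finset.mul_prod_erase _ _ (Finset.mem_univ i)]
  simp only [if_true]
  congr 1
  rw [Finset.prod_congr rfl (g := fun _ => ∫ ξ, ‖h ξ‖)
    fun j hj => by rw [if_neg (Finset.ne_of_mem_erase hj)]]
  simp [Finset.card_erase_of_mem]

/-- By symmetry of the tensor power, the weight on any one of the `p + 1` variables gives the same
product integral. -/
theorem integrable_weight_mul_norm_tensorPow (hi : Integrable h)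
    (hs : Integrable fun ξ => |ξ| ^ s * ‖h ξ‖) (p : ℕ) :
    Integrable (fun q : ℝ × (Fin p → ℝ) =>
      (|q.1| ^ s + ∑ j, |q.2 j| ^ s) * ‖tensorPow h p q‖) ∧
    ∫ q : ℝ × (Fin p → ℝ), (|q.1| ^ s + ∑ j, |q.2 j| ^ s) * ‖tensorPow h p q‖ =
      (p + 1) * ((∫ ξ, |ξ| ^ s * ‖h ξ‖) * (∫ ξ, ‖h ξ‖) ^ p) := by
  have he : ∀ q : ℝ × (Fin p → ℝ), (|q.1| ^ s + ∑ j, |q.2 j| ^ s) * ‖tensorPow h p q‖ =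
      (|q.1| ^ s * ‖h q.1‖) * ‖∏ j, h (q.2 j)‖ +
        ∑ i, ‖h q.1‖ * (|q.2 i| ^ s * ‖∏ j, h (q.2 j)‖) := fun q => by
    rw [tensorPow, norm_mul, add_mul, Finset.sum_mul]
    congr 1
    · ring
    · exact Finset.sum_congr rfl fun i _ => by ring
  have hp : Integrable fun ω : Fin p → ℝ => ∏ j, h (ω j) :=
    Integrable.fintype_prod fun _ => hi
  have h1 : Integrable fun q : ℝ × (Fin p → ℝ) => (|q.1| ^ s * ‖h q.1‖) * ‖∏ j, h (q.2 j)‖ :=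
    hs.mul_prod hp.norm
  have h2 : ∀ i : Fin p, Integrable fun q : ℝ × (Fin p → ℝ) =>
      ‖h q.1‖ * (|q.2 i| ^ s * ‖∏ j, h (q.2 j)‖) := fun i =>
    hi.norm.mul_prod (integrable_rpow_mul_norm_prod hi hs i)
  simp_rw [he]
  refine ⟨h1.add (integrable_finsetSum _ fun i _ => h2 i), ?_⟩
  rw [integral_add h1 (integrable_finsetSum _ fun i _ => h2 i),
    integral_finsetSum _ fun i _ => h2 i]
  have h3 : ∫ q : ℝ × (Fin p → ℝ), (|q.1| ^ s * ‖h q.1‖) * ‖∏ j, h (q.2 j)‖ =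
      (∫ ξ, |ξ| ^ s * ‖h ξ‖) * (∫ ξ, ‖h ξ‖) ^ p := by
    simp_rw [norm_prod]
    rw [Measure.volume_eq_prod, integral_prod_mul (fun ξ => |ξ| ^ s * ‖h ξ‖)
      (fun ω : Fin p → ℝ => ∏ j, ‖h (ω j)‖),
      integral_fintype_prod_volume_eq_pow (fun ξ => ‖h ξ‖), Fintype.card_fin]
  have h4 : ∀ i : Fin p, ∫ q : ℝ × (Fin p → ℝ),
      ‖h q.1‖ * (|q.2 i| ^ s * ‖∏ j, h (q.2 j)‖) =
      (∫ ξ, |ξ| ^ s * ‖h ξ‖) * (∫ ξ, ‖h ξ‖) ^ p := fun i => by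
    rw [Measure.volume_eq_prod, integral_prod_mul (fun ξ => ‖h ξ‖)
      (fun ω : Fin p → ℝ => |ω i| ^ s * ‖∏ j, h (ω j)‖), integral_rpow_mul_norm_prod]
    -- The exponent `p - 1` is a truncated subtraction, so recombining the powers needs `p ≥ 1`.
    have hp0 : p ≠ 0 := by
      rintro rfl
      exact i.elim0
    rw [mul_left_comm, mul_pow_sub_one hp0]
  rw [h3, Finset.sum_congr rfl fun i _ => h4 i]
  simp
  ring

theorem lintegral_rpow_mul_enorm_pvDensity_le (hs0 : 0 ≤ s) (hi : Integrable h) (h0 : h 0 = 0)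
    (hs : Integrable fun ξ => |ξ| ^ s * ‖h ξ‖) {p : ℕ} (i : Fin p) :
    ∫⁻ η, ENNReal.ofReal (|η| ^ s) * ‖pvDensity h p η‖ₑ ≤
      ENNReal.ofReal (12 * ((p : ℝ) + 1) ^ s *
        ((p + 1) * ((∫ ξ, |ξ| ^ s * ‖h ξ‖) * (∫ ξ, ‖h ξ‖) ^ p))) := by
  obtain ⟨h1, h2⟩ := integrable_weight_mul_norm_tensorPow hi hs p
  refine (lintegral_mul_enorm_shearDensity_le (τ := fun ω : Fin p → ℝ => ∑ j, ω j)
    (by fun_prop) (integrable_tensorPow_mul_pvMultiplier hi h0 i)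
    (w := fun η => ENNReal.ofReal (|η| ^ s)) (by fun_prop) (fun _ => ENNReal.ofReal_ne_top)).trans ?_
  rw [← h2, ← integral_const_mul, ofReal_integral_eq_lintegral_ofReal (h1.const_mul _)
    (ae_of_all _ fun _ => by positivity)]
  refine lintegral_mono fun q => ?_
  rw [← ofReal_norm, ← ENNReal.ofReal_mul (by positivity)]
  refine ENNReal.ofReal_le_ofReal ?_
  calc _ ≤ (((p : ℝ) + 1) ^ s * (|q.1| ^ s + ∑ j, |q.2 j| ^ s)) * (12 * ‖tensorPow h p q‖) := by
        gcongr
        · exact abs_add_sum_rpow_le hs0 _ _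
        · exact norm_tensorPow_mul_pvMultiplier_le h0 i q
    _ = _ := by ring

theorem lintegral_rpow_mul_enorm_selfDensity_le (hs0 : 0 ≤ s) (hi : Integrable h) (h0 : h 0 = 0)
    (hs : Integrable fun ξ => |ξ| ^ s * ‖h ξ‖) :
    ∫⁻ η, ENNReal.ofReal (|η| ^ s) * ‖selfDensity h η‖ₑ ≤
      ∑' m : ℕ, ENNReal.ofReal (12 * (2 * ((m : ℝ) + 1) + 1) ^ s *
        ((2 * ((m : ℝ) + 1) + 1) * ((∫ ξ, |ξ| ^ s * ‖h ξ‖) *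
          (∫ ξ, ‖h ξ‖) ^ (2 * (m + 1))))) := by
  calc _ ≤ ∫⁻ η, ∑' m : ℕ, ENNReal.ofReal (|η| ^ s) * ‖pvDensity h (2 * (m + 1)) η‖ₑ := by
        refine lintegral_mono fun η => ?_
        rw [ENNReal.tsum_mul_left]
        gcongr
        refine enorm_tsum_le_tsum_enorm.trans_eq ?_
        simp_rw [enorm_mul, enorm_pow, enorm_neg, enorm_one, one_pow, one_mul]
    _ = ∑' m : ℕ, ∫⁻ η, ENNReal.ofReal (|η| ^ s) * ‖pvDensity h (2 * (m + 1)) η‖ₑ :=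
        lintegral_tsum fun m => AEMeasurable.mul (by fun_prop)
          (integrable_pvDensity hi h0 ⟨0, by omega⟩).aestronglyMeasurable.enorm
    _ ≤ _ := by
        refine ENNReal.tsum_le_tsum fun m => ?_
        have := lintegral_rpow_mul_enorm_pvDensity_le hs0 hi h0 hs
          (p := 2 * (m + 1)) ⟨0, by omega⟩
        push_cast at this
        exact this

end Weighted

/-! ### The self-interaction estimate -/

theorem IsFourierTransform.wienerNorm_eq_ofReal {u : ℝ → ℝ} {U : ℝ → ℂ} {s : ℝ} (hs : 0 ≤ s)
    (hU : IsFourierTransform u U) (h : wienerNorm s u < ∞) :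
    wienerNorm s u = ENNReal.ofReal (∫ ξ, |ξ| ^ s * ‖U ξ‖) := by
  rw [ofReal_integral_eq_lintegral_ofReal (hU.integrable_rpow_mul hs h)
    (ae_of_all _ fun _ => by positivity), wienerNorm_eq hU]
  congr 1 with ξ
  rw [ENNReal.ofReal_mul (by positivity), ofReal_norm]

/-- Absorbs the loss of `p + 1` from the symmetric sum into the inversion constants. -/
theorem natCast_succ_le_two_pi_pow (p : ℕ) : (p : ℝ) + 1 ≤ (2 * Real.pi) ^ (p + 1) := by
  have h1 : ((p + 1 : ℕ) : ℝ) ≤ 2 ^ (p + 1) := by exact_mod_cast Nat.lt_two_pow_self.le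
  have h2 : (2 : ℝ) ≤ 2 * Real.pi := by linarith [Real.pi_gt_three]
  push_cast at h1
  exact h1.trans (pow_le_pow_left₀ zero_le_two h2 _)

theorem selfInteraction_estimate {n : ℕ} (ρ : Fin (n + 1) → ℝ) {s : ℝ} (hs : 0 ≤ s) (k : Fin n)
    {g : ℝ → ℝ} (hg : Continuous g) (hs1 : wienerNorm (s + 1) g < ∞) (h1 : wienerNorm 1 g < 1) :
    (∀ x : ℝ, HasPrincipalValue (selfKernel g x) (principalValue (selfKernel g x))) ∧
      wienerNorm s (selfInteraction ρ k g) ≤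
        ENNReal.ofReal (12 * |ρ k.castSucc - ρ k.succ|) *
          (seriesF s (wienerNorm 1 g) * wienerNorm (s + 1) g) := by
  have h1' : wienerNorm 1 g < ∞ := h1.trans ENNReal.one_lt_top
  obtain ⟨U, hU⟩ := exists_isFourierTransform_of_wienerNorm_lt_top h1'
  have hUi : Integrable U := hU.integrable h1'
  have hpic : (Real.pi : ℂ) ≠ 0 := by exact_mod_cast Real.pi_ne_zero
  set G : ℝ := ∫ ξ, |ξ| ^ (1 : ℝ) * ‖U ξ‖
  set S : ℝ := ∫ ξ, |ξ| ^ (s + 1) * ‖U ξ‖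
  have hG0 : 0 ≤ G := by positivity
  have hS0 : 0 ≤ S := by positivity
  have hGe : wienerNorm 1 g = ENNReal.ofReal G := hU.wienerNorm_eq_ofReal zero_le_one h1'
  have hSe : wienerNorm (s + 1) g = ENNReal.ofReal S :=
    hU.wienerNorm_eq_ofReal (by linarith) hs1
  have hG1 : G < 1 := by
    rw [hGe] at h1
    exact ENNReal.ofReal_lt_one.1 h1
  set V : ℝ → ℂ := fun ξ => (2 * Real.pi : ℂ)⁻¹ * U ξ with hVdef
  set h : ℝ → ℂ := fun ξ => Complex.I * ξ * V ξ
  have hV : Integrable V := hUi.const_mul _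
  have hgV : ∀ x, (g x : ℂ) = waveInt V x := hU.eq_waveInt hg hUi
  have hh : ∀ ξ : ℝ, h ξ = Complex.I * ξ * V ξ := fun _ => rfl
  have h0 : h 0 = 0 := by simp [hh]
  have hn : ∀ ξ, ‖h ξ‖ = (2 * Real.pi)⁻¹ * (|ξ| ^ (1 : ℝ) * ‖U ξ‖) := fun ξ => by
    simp [hh, hVdef, abs_of_pos Real.pi_pos]
    ring
  have hns : ∀ ξ, |ξ| ^ s * ‖h ξ‖ = (2 * Real.pi)⁻¹ * (|ξ| ^ (s + 1) * ‖U ξ‖) := fun ξ => by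
    rw [hn, Real.rpow_add_of_nonneg (abs_nonneg _) hs zero_le_one]
    ring
  have hi : Integrable h := by
    have hm : AEStronglyMeasurable h :=
      (Measurable.aestronglyMeasurable (by fun_prop)).mul hV.aestronglyMeasurable
    rw [← integrable_norm_iff hm]
    simp_rw [hn]
    exact (hU.integrable_rpow_mul zero_le_one h1').const_mul _
  have his : Integrable fun ξ => |ξ| ^ s * ‖h ξ‖ := by
    simp_rw [hns]
    exact (hU.integrable_rpow_mul (by linarith) hs1).const_mul _
  have hH : ∫ ξ, ‖h ξ‖ = (2 * Real.pi)⁻¹ * G := by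
    simp_rw [hn]
    rw [integral_const_mul]
  have hHs : ∫ ξ, |ξ| ^ s * ‖h ξ‖ = (2 * Real.pi)⁻¹ * S := by
    simp_rw [hns]
    rw [integral_const_mul]
  have hlt : ∫ ξ, ‖h ξ‖ < 1 := by
    rw [hH]
    refine lt_of_le_of_lt (mul_le_of_le_one_left hG0 (inv_le_one_of_one_le₀ ?_)) hG1
    linarith [Real.pi_gt_three]
  have hpv := hasPrincipalValue_selfKernel hV hi hh hgV hlt
  refine ⟨fun x => (hpv x).1, ?_⟩
  set c : ℝ := (ρ k.castSucc - ρ k.succ) / (2 * Real.pi) with hc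
  have hN : ∀ x, (selfInteraction ρ k g x : ℂ) =
      waveInt (fun η => (c : ℂ) * selfDensity h η) x := fun x => by
    have hw : waveInt (fun η => (c : ℂ) * selfDensity h η) x =
        c * waveInt (selfDensity h) x := by
      simp_rw [waveInt, mul_assoc]
      exact integral_const_mul _ _
    rw [hw, ← (hpv x).2, selfInteraction, Complex.ofReal_mul]
  have hFN := isFourierTransform_of_waveInt ((integrable_selfDensity hi h0 hlt).const_mul _) hN
  -- The `2π` of the Fourier normalization cancels the `1/2π` in the definition of the nonlinearity.
  have hce : ∀ η, ‖2 * Real.pi * ((c : ℂ) * selfDensity h η)‖ₑ =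
      ENNReal.ofReal |ρ k.castSucc - ρ k.succ| * ‖selfDensity h η‖ₑ := fun η => by
    rw [← mul_assoc, enorm_mul]
    congr 1
    rw [← ofReal_norm, hc, ← Real.norm_eq_abs, ← Complex.norm_real]
    congr 2
    push_cast
    field_simp
  rw [wienerNorm_eq hFN]
  simp_rw [hce, mul_left_comm _ (ENNReal.ofReal |ρ k.castSucc - ρ k.succ|)]
  rw [lintegral_const_mul' _ _ ENNReal.ofReal_ne_top, mul_comm (12 : ℝ),
    ENNReal.ofReal_mul (abs_nonneg _), mul_assoc]
  gcongr
  refine (lintegral_rpow_mul_enorm_selfDensity_le hs hi h0 his).trans ?_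
  rw [hH, hHs, hGe, hSe, seriesF, ← ENNReal.tsum_mul_right, ← ENNReal.tsum_mul_left]
  refine ENNReal.tsum_le_tsum fun m => ?_
  rw [← ENNReal.ofReal_pow hG0, ← ENNReal.ofReal_mul (by positivity),
    ← ENNReal.ofReal_mul (by positivity), ← ENNReal.ofReal_mul (by positivity)]
  refine ENNReal.ofReal_le_ofReal ?_
  have hp := natCast_succ_le_two_pi_pow (2 * (m + 1))
  push_cast at hp
  have hle : (2 * ((m : ℝ) + 1) + 1) * ((2 * Real.pi)⁻¹ ^ (2 * (m + 1) + 1)) ≤ 1 := by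
    rw [inv_pow, ← div_eq_mul_inv]
    exact div_le_one_of_le₀ hp (by positivity)
  -- The `2m + 2` factors from the powers and one from the weighted integral give `(2π)⁻¹` to the
  -- power `2m + 3`.
  calc _ = 12 * ((2 * ((m : ℝ) + 1) + 1) ^ s * G ^ (2 * (m + 1)) * S) *
        ((2 * ((m : ℝ) + 1) + 1) * ((2 * Real.pi)⁻¹ ^ (2 * (m + 1) + 1))) := by
        rw [mul_pow, pow_succ]
        ring
    _ ≤ _ := mul_le_of_le_one_right (by positivity) hle

/-! ### The case `‖g‖_1 ≥ 1`. -/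

theorem seriesF_eq_top {s : ℝ} (hs : 0 ≤ s) {x : ℝ≥0∞} (hx : 1 ≤ x) : seriesF s x = ∞ := by
  rw [eq_top_iff, ← ENNReal.tsum_const_eq_top_of_ne_zero (α := ℕ) one_ne_zero]
  refine ENNReal.tsum_le_tsum fun m => ?_
  rw [← one_mul (1 : ℝ≥0∞)]
  refine mul_le_mul' ?_ (one_le_pow₀ hx)
  rw [ENNReal.one_le_ofReal]
  exact Real.one_le_rpow (by linarith [(Nat.cast_nonneg m : (0 : ℝ) ≤ m)]) hs

/-- The weight `|ξ|^s` is positive off a null set, so the transform vanishes almost everywhere. -/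
theorem wienerNorm_one_eq_zero {s : ℝ} {u : ℝ → ℝ} (h : wienerNorm s u = 0) :
    wienerNorm 1 u = 0 := by
  obtain ⟨U, hU⟩ := exists_isFourierTransform_of_wienerNorm_lt_top (h ▸ ENNReal.zero_lt_top)
  have hm := hU.locallyIntegrable.aestronglyMeasurable.enorm
  rw [wienerNorm_eq hU] at h ⊢
  have hm' : ∀ t : ℝ, AEMeasurable fun ξ : ℝ => ENNReal.ofReal (|ξ| ^ t) * ‖U ξ‖ₑ :=
    fun t => AEMeasurable.mul (by fun_prop) hm
  rw [lintegral_eq_zero_iff' (hm' _)] at h ⊢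
  have hne : ∀ᵐ ξ : ℝ, ξ ≠ 0 := by simp [ae_iff]
  filter_upwards [h, hne] with ξ hξ hξ0
  have hpos : 0 < |ξ| ^ s := Real.rpow_pos_of_pos (abs_pos.2 hξ0) s
  have : ENNReal.ofReal (|ξ| ^ s) ≠ 0 := by simpa using hpos
  have hU0 : ‖U ξ‖ₑ = 0 := (mul_eq_zero.1 hξ).resolve_left this
  simp [hU0]

end

theorem mainTheorem6 {n : ℕ} (ρ : Fin (n + 1) → ℝ) :
    ∃ C : ℝ≥0, ∀ (s : ℝ), 0 ≤ s → ∀ (k : Fin n) (g : ℝ → ℝ), Continuous g →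
      wienerNorm (s + 1) g < ∞ → wienerNorm 1 g < ∞ →
        (wienerNorm 1 g < 1 →
          ∀ x : ℝ, HasPrincipalValue (selfKernel g x) (principalValue (selfKernel g x))) ∧
        wienerNorm s (selfInteraction ρ k g) ≤
          C * (seriesF s (wienerNorm 1 g) * wienerNorm (s + 1) g) := by
  -- The sum makes the constant independent of `k`; the added 1 keeps it nonzero even for equal
  -- densities, so that the product with `∞` below is `∞`.
  refine ⟨Real.toNNReal (1 + ∑ k : Fin n, 12 * |ρ k.castSucc - ρ k.succ|),
    fun s hs k g hg hs1 _ => ⟨fun h1 => (selfInteraction_estimate ρ hs k hg hs1 h1).1, ?_⟩⟩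
  rcases lt_or_ge (wienerNorm 1 g) 1 with h1 | h1
  · refine (selfInteraction_estimate ρ hs k hg hs1 h1).2.trans ?_
    gcongr
    refine ENNReal.ofReal_le_ofReal ?_
    have := Finset.single_le_sum (f := fun k : Fin n => 12 * |ρ k.castSucc - ρ k.succ|)
      (fun _ _ => by positivity) (Finset.mem_univ k)
    linarith
  · have hne : wienerNorm (s + 1) g ≠ 0 := fun h => by
      rw [wienerNorm_one_eq_zero h] at h1
      simp at h1
    have hC : ((Real.toNNReal (1 + ∑ k : Fin n, 12 * |ρ k.castSucc - ρ k.succ|) : ℝ≥0) : ℝ≥0∞) ≠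
        0 := by
      have : 0 < 1 + ∑ k : Fin n, 12 * |ρ k.castSucc - ρ k.succ| := by positivity
      simpa using this
    rw [seriesF_eq_top hs h1, ENNReal.top_mul hne, ENNReal.mul_top hC]
    exact le_top
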